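/- **Setting.** Let $H$ be a real separable Hilbert space with Borel $\sigma$-algebra $\mathcal B$, let $(T_t)_{t\ge 0}$ be a strongly continuous semigroup of bounded linear operators on $H$ with (possibly unbounded) generator $A$, and let $(\mu_t)_{t\ge 0}$ be Borel probability measures on $H$ with $\mu_0=\delta_0$, $\mu_t\to\delta_0$ weakly as $t\to 0$, and $\mu_{t+s}=(\mu_t\circ T_s^{-1})*\mu_s$ for all $s,t\ge 0$. For $f\ge 0$ measurable, $\alpha>0$ and $x\in H$ put $$P_tf(x)=\int_H f(T_tx+y)\,\mu_t(dy),\qquad U_\alpha f(x)=\int_0^\infty e^{-\alpha t}P_tf(x)\,dt .$$ $\mathcal U=(U_\alpha)_{\alpha>0}$ is the Mehler resolvent. For measurable $f:H\to[-\infty,\infty]$ put $U_\alpha f=U_\alpha f^+-U_\alpha f^-$ whenever at each point at least one of the two terms is finite. **Condition $(H_{A,\mu})$.** (i) There are an orthonormal basis $(e_i)_{i\ge 1}$ of $H$ and numbers $\lambda_i\in\mathbb R\setminus\{0\}$ decreasing to $-\infty$ such that $A^*e_i=\lambda_ie_i$ for all $i\ge1$. (ii) There are $p\ge 2$, $a>0$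 and $q>p\lambda_1$ with $$\sum_{i\ge 1}|\lambda_i|^{1+a}\int_0^\infty e^{-qt}\int_H \big(|\langle y,e_i\rangle|^p\wedge 1\big)\,\mu_t(dy)\,dt<\infty,$$ $$\sum_{i\ge 1}|\lambda_i|^a e^{p\lambda_i t}<\infty\quad\text{for all } t>0,\qquad \sum_{i\ge 1}|\lambda_i|^{-\frac{2a}{p-2}}<\infty ,$$ where the last requirement is dropped if $p=2$. (iii) There is $0<\gamma\le 1$ such that $\int_0^\infty e^{-qt}\int_H|\langle y,e_i\rangle|^\gamma\,\mu_t(dy)\,dt<\infty$ for all $i\ge 1$. **Definitions.** For $\beta\ge 0$, $\mathcal E_\beta$ is the set of measurable $v:H\to[0,\infty]$ with $\gamma U_{\gamma+\beta}v\le v$ for all $\gamma>0$ and $\sup_{\gamma>0}\gamma U_{\gamma+\beta}v=v$ pointwise. For $\beta>0$, $D\in\mathcal B$ and $u\in\mathcal E_\beta$ let $R_\beta^Du=\inf\{v\in\mathcal E_\beta: v\ge u\text{ on }D\}$ and $B_\beta^Du=\sup_{\gamma>0}\gamma U_{\gamma+\beta}(R_\beta^Du)$. * An increasing sequence $(F_n)_{n\ge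 1}\subset\mathcal B$ is a *$\mathcal U$-nest* if there are $\beta>0$ and a strictly positive bounded $u\in\mathcal E_\beta$ with $\lim_n B_\beta^{H\setminus F_n}u=0$ everywhere on $H$. * A topology $\tau$ on $H$ is a *$\mathcal U$-topology* if there are numbers $\alpha_k$ and measurable functions $f_k$ ($k\ge 1$), a number $\alpha_0\ge0$ and $V\in\mathcal E_{\alpha_0}$ such that $\alpha_k\ge\alpha_1>\alpha_0$ and $|f_k|\le V$ for all $k$; $U_1(1_{[V=\infty]})=0$; the functions $U_{\alpha_k}f_k$ are well defined and $\tau$ is the topology generated by them; and any two probability measures $\nu_1,\nu_2$ on $H$ with $\nu_j(U_{\alpha_k}|f_k|)<\infty$ and $\nu_1(U_{\alpha_k}f_k)=\nu_2(U_{\alpha_k}f_k)$ for $j=1,2$ and all $k\ge 1$ are equal. * A topology $\tau$ on $H$ is a *quasi-$\mathcal U$-topology with attached $\mathcal U$-nest $(F_n)_{n\ge 1}$* if $(F_n)_{n\ge1}$ is a $\mathcal U$-nest and there is a $\mathcal U$-topology $\overline\tau$ such that, for every $n\ge1$, $\tau|_{F_n}=\overline\tau|_{F_n}$ and $F_n$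 is closed for both $\tau$ and $\overline\tau$. **Proposition.** If $A$ is bounded or $(H_{A,\mu})$ holds, then the weak topology on $H$ is a quasi-$\mathcal U$-topology with attached $\mathcal U$-nest $(\overline{B(0,n)})_{n\ge 1}$, where $\overline{B(0,n)}=\{x\in H:\|x\|\le n\}$. -/

import Mathlib

open Filter Topology MeasureTheory Set
open scoped ENNReal

namespace MehlerWeak

/-! ### Potential theory of a resolvent

A family of kernels `(U_α)` on a measurable space `E` is represented by its action
`U α f x = ∫ f(y) U_α(x, dy)` on functions `f : E → [0,∞]`. -/

section Potential

variable {E : Type*}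

/-- `v` belongs to the cone `𝓔(𝓤_β)` of (Borel) measurable `𝓤_β`-excessive functions:
`γ U_{γ+β} v ≤ v` for all `γ > 0`, and `sup_γ γ U_{γ+β} v = v` pointwise.
The case `β = 0` is that of `𝓤`-excessive functions. -/
structure IsExcessive [MeasurableSpace E] (U : ℝ → (E → ℝ≥0∞) → E → ℝ≥0∞) (β : ℝ)
    (v : E → ℝ≥0∞) : Prop where
  measurable : Measurable v
  supermedian : ∀ γ : ℝ, 0 < γ → ∀ x, ENNReal.ofReal γ * U (γ + β) v x ≤ v x
  iSup_eq : ∀ x, (⨆ (γ : ℝ) (_ : 0 < γ), ENNReal.ofReal γ * U (γ + β) v x) = v x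

/-- The reduced function `R_β^A u = inf {v ∈ 𝓔(𝓤_β) : v ≥ u on A}` (pointwise infimum). -/
noncomputable def reduced [MeasurableSpace E] (U : ℝ → (E → ℝ≥0∞) → E → ℝ≥0∞) (β : ℝ)
    (A : Set E) (u : E → ℝ≥0∞) (x : E) : ℝ≥0∞ :=
  ⨅ (v : E → ℝ≥0∞) (_ : IsExcessive U β v) (_ : ∀ y ∈ A, u y ≤ v y), v x

/-- The balayage `B_β^A u`: the excessive regularization `sup_γ γ U_{γ+β} (R_β^A u)` of the
reduced function. -/
noncomputable def balayage [MeasurableSpace E] (U : ℝ → (E → ℝ≥0∞) → E → ℝ≥0∞) (β : ℝ)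
    (A : Set E) (u : E → ℝ≥0∞) (x : E) : ℝ≥0∞ :=
  ⨆ (γ : ℝ) (_ : 0 < γ), ENNReal.ofReal γ * U (γ + β) (reduced U β A u) x

/-- An increasing sequence of measurable sets `F_n` is a `𝓤`-nest if for some `β > 0` and some
strictly positive bounded `u ∈ 𝓔(𝓤_β)` one has `B_β^{E ∖ F_n} u → 0` pointwise on `E`. -/
structure IsNest [MeasurableSpace E] (U : ℝ → (E → ℝ≥0∞) → E → ℝ≥0∞) (F : ℕ → Set E) :
    Prop where
  mono : Monotone F
  measurableSet : ∀ n, MeasurableSet (F n)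
  tendsto : ∃ (β : ℝ) (u : E → ℝ≥0∞), 0 < β ∧ IsExcessive U β u ∧ (∀ x, 0 < u x) ∧
    (∃ C : ℝ≥0∞, C < ∞ ∧ ∀ x, u x ≤ C) ∧
    ∀ x, Tendsto (fun n => balayage U β (F n)ᶜ u x) atTop (𝓝 0)

/-- `U_α f` for a numerical function `f`, namely `U_α f⁺ - U_α f⁻`. It is the integral of `f`
whenever `U_α f⁺ (x)` and `U_α f⁻ (x)` are not both infinite, see `PotentialDefined`. -/
noncomputable def potential (U : ℝ → (E → ℝ≥0∞) → E → ℝ≥0∞) (α : ℝ) (f : E → EReal)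
    (x : E) : EReal :=
  ((U α (fun y => (f y).toENNReal) x : ℝ≥0∞) : EReal) -
    ((U α (fun y => (-f y).toENNReal) x : ℝ≥0∞) : EReal)

/-- The integral defining `U_α f` makes sense (in `[-∞,∞]`) at every point. -/
def PotentialDefined (U : ℝ → (E → ℝ≥0∞) → E → ℝ≥0∞) (α : ℝ) (f : E → EReal) : Prop :=
  ∀ x, U α (fun y => (f y).toENNReal) x < ∞ ∨ U α (fun y => (-f y).toENNReal) x < ∞

/-- `τ` is a `𝓤`-topology: it is generated by functions `U_{α_k} f_k` such that
`α_k ≥ α_0 > a`, `|f_k| ≤ V` for some `V ∈ 𝓔(𝓤_a)` with `U_1 1_{[V = ∞]} = 0`, and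
the `U_{α_k} f_k` separate the probability measures `ν` with `ν(U_{α_k} |f_k|) < ∞` for all `k`.
The sequences are indexed from `0`. -/
def IsUTopology [MeasurableSpace E] (U : ℝ → (E → ℝ≥0∞) → E → ℝ≥0∞)
    (τ : TopologicalSpace E) : Prop :=
  ∃ (α : ℕ → ℝ) (f : ℕ → E → EReal) (a : ℝ) (V : E → ℝ≥0∞),
    (0 ≤ a ∧ a < α 0 ∧ ∀ k, α 0 ≤ α k) ∧
    (∀ k, Measurable (f k)) ∧
    IsExcessive U a V ∧
    (∀ x, U 1 ({y | V y = ∞}.indicator 1) x = 0) ∧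
    (∀ k x, (f k x).abs ≤ V x) ∧
    (∀ k, PotentialDefined U (α k) (f k)) ∧
    (τ = ⨅ k, TopologicalSpace.induced (potential U (α k) (f k)) inferInstance) ∧
    (∀ ν₁ ν₂ : ProbabilityMeasure E,
      (∀ k, ∫⁻ x, U (α k) (fun y => (f k y).abs) x ∂(ν₁ : Measure E) < ∞) →
      (∀ k, ∫⁻ x, U (α k) (fun y => (f k y).abs) x ∂(ν₂ : Measure E) < ∞) →
      (∀ k, ∫ x, (potential U (α k) (f k) x).toReal ∂(ν₁ : Measure E) =
        ∫ x, (potential U (α k) (f k) x).toReal ∂(ν₂ : Measure E)) →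
      ν₁ = ν₂)

/-- `τ` is a quasi-`𝓤`-topology with attached `𝓤`-nest `(F_n)`: there is a `𝓤`-topology `τ'`
such that `τ` and `τ'` induce the same topology on each `F_n`, and each `F_n` is closed for both
`τ` and `τ'`. -/
def IsQuasiUTopology [MeasurableSpace E] (U : ℝ → (E → ℝ≥0∞) → E → ℝ≥0∞)
    (τ : TopologicalSpace E) (F : ℕ → Set E) : Prop :=
  IsNest U F ∧ ∃ τ' : TopologicalSpace E, IsUTopology U τ' ∧ ∀ n,
    TopologicalSpace.induced ((↑) : F n → E) τ = TopologicalSpace.induced ((↑) : F n → E) τ' ∧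
    IsClosed[τ] (F n) ∧ IsClosed[τ'] (F n)

end Potential

/-! ### Generalized Mehler semigroups -/

section Mehler

variable {H : Type*} [NormedAddCommGroup H] [InnerProductSpace ℝ H]

/-- `(T_t)_{t ≥ 0}` is a strongly continuous semigroup of bounded operators (only the values of
`T` at times `t ≥ 0` matter). -/
structure IsC0Semigroup (T : ℝ → H →L[ℝ] H) : Prop where
  zero : T 0 = ContinuousLinearMap.id ℝ H
  add : ∀ s t : ℝ, 0 ≤ s → 0 ≤ t → T (s + t) = (T s).comp (T t)
  continuousOn : ∀ x, ContinuousOn (fun t => T t x) (Ici 0)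

/-- The domain of the infinitesimal generator: all `x` such that `(T_t x - x) / t` converges in
norm as `t ↓ 0`. -/
def generatorDomain (T : ℝ → H →L[ℝ] H) : Submodule ℝ H where
  carrier := {x | ∃ y, Tendsto (fun t : ℝ => t⁻¹ • (T t x - x)) (𝓝[>] 0) (𝓝 y)}
  zero_mem' := ⟨0, by simp⟩
  add_mem' := by
    rintro a b ⟨y, hy⟩ ⟨z, hz⟩
    refine ⟨y + z, (hy.add hz).congr fun t => ?_⟩
    rw [map_add, ← smul_add]
    congr 1
    abel
  smul_mem' := by
    rintro c a ⟨y, hy⟩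
    refine ⟨c • y, (hy.const_smul c).congr fun t => ?_⟩
    rw [map_smul, ← smul_sub, smul_comm]

theorem generatorDomain_spec (T : ℝ → H →L[ℝ] H) (x : generatorDomain T) :
    ∃ y, Tendsto (fun t : ℝ => t⁻¹ • (T t x - x)) (𝓝[>] 0) (𝓝 y) := x.2

/-- The infinitesimal generator `A` of `(T_t)`, a possibly unbounded operator:
`A x = lim_{t ↓ 0} (T_t x - x) / t` for `x` in its domain. -/
noncomputable def generator (T : ℝ → H →L[ℝ] H) : H →ₗ.[ℝ] H where
  domain := generatorDomain T
  toFun :=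
    { toFun := fun x => (generatorDomain_spec T x).choose
      map_add' := fun a b => by
        refine tendsto_nhds_unique (generatorDomain_spec T (a + b)).choose_spec ?_
        refine ((generatorDomain_spec T a).choose_spec.add
          (generatorDomain_spec T b).choose_spec).congr fun t => ?_
        rw [Submodule.coe_add, map_add, ← smul_add]
        congr 1
        abel
      map_smul' := fun c a => by
        refine tendsto_nhds_unique (generatorDomain_spec T (c • a)).choose_spec ?_
        refine ((generatorDomain_spec T a).choose_spec.const_smul c).congr fun t => ?_
        rw [Submodule.coe_smul, map_smul, ← smul_sub, smul_comm] }

theorem tendsto_generator (T : ℝ → H →L[ℝ] H) (x : (generator T).domain) :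
    Tendsto (fun t : ℝ => t⁻¹ • (T t x - x)) (𝓝[>] 0) (𝓝 (generator T x)) :=
  (generatorDomain_spec T x).choose_spec

/-- The generator is a bounded operator. (The generator of a strongly continuous semigroup is
closed and densely defined, so its domain is then the whole space.) -/
def GeneratorBounded (T : ℝ → H →L[ℝ] H) : Prop :=
  ∃ C : ℝ, ∀ x : (generator T).domain, ‖generator T x‖ ≤ C * ‖(x : H)‖

variable [MeasurableSpace H] [BorelSpace H]

/-- The conditions on the probability measures `(μ_t)_{t ≥ 0}` of a generalized Mehler semigroup:
`μ_t → μ_0 = δ_0` weakly as `t → 0`, and `μ_{t+s} = (μ_t ∘ T_s⁻¹) ∗ μ_s`. -/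
structure IsMehlerFamily (T : ℝ → H →L[ℝ] H) (μ : ℝ → ProbabilityMeasure H) : Prop where
  zero : (μ 0 : Measure H) = Measure.dirac 0
  tendsto : Tendsto μ (𝓝[>] 0) (𝓝 (μ 0))
  add : ∀ s t : ℝ, 0 ≤ s → 0 ≤ t →
    (μ (t + s) : Measure H) = Measure.conv ((μ t : Measure H).map (T s)) (μ s)

/-- The generalized Mehler semigroup `P_t f(x) = ∫ f(T_t x + y) μ_t(dy)` on `[0,∞]`-valued
functions. -/
noncomputable def mehlerSemigroup (T : ℝ → H →L[ℝ] H) (μ : ℝ → ProbabilityMeasure H) (t : ℝ)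
    (f : H → ℝ≥0∞) (x : H) : ℝ≥0∞ :=
  ∫⁻ y, f (T t x + y) ∂(μ t : Measure H)

/-- The Mehler resolvent `U_α f(x) = ∫_0^∞ e^{-αt} P_t f(x) dt`. -/
noncomputable def mehlerResolvent (T : ℝ → H →L[ℝ] H) (μ : ℝ → ProbabilityMeasure H) (α : ℝ)
    (f : H → ℝ≥0∞) (x : H) : ℝ≥0∞ :=
  ∫⁻ t in Ioi (0 : ℝ), ENNReal.ofReal (Real.exp (-α * t)) * mehlerSemigroup T μ t f x

/-- The condition `(H_{A,μ})`, the eigenbasis being indexed from `0`: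
(i) `A* e_i = λ_i e_i` for an orthonormal basis `(e_i)`, with nonzero real `λ_i` decreasing to
`-∞`;
(ii) the spectral bounds with exponents `p ≥ 2`, `a > 0` and a number `q > p λ_0`;
(iii) the moment bound of some order `γ ∈ (0,1]`.
For `p = 2` the exponent `2a/(p-2)` is infinite and the last series condition in (ii) is void. -/
def ConditionHAmu [CompleteSpace H] (T : ℝ → H →L[ℝ] H) (μ : ℝ → ProbabilityMeasure H) : Prop :=
  ∃ (e : HilbertBasis ℕ ℝ H) (lam : ℕ → ℝ) (p a q γ : ℝ),
    (∀ i, ∃ h : e i ∈ (generator T).adjoint.domain,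
      (generator T).adjoint ⟨e i, h⟩ = lam i • e i) ∧
    (∀ i, lam i ≠ 0) ∧ Antitone lam ∧ Tendsto lam atTop atBot ∧
    2 ≤ p ∧ 0 < a ∧ p * lam 0 < q ∧
    (∑' i, ENNReal.ofReal (|lam i| ^ (1 + a)) *
      ∫⁻ t in Ioi (0 : ℝ), ENNReal.ofReal (Real.exp (-q * t)) *
        ∫⁻ y, ENNReal.ofReal (min (|inner ℝ y (e i)| ^ p) 1) ∂(μ t : Measure H)) < ∞ ∧
    (∀ t : ℝ, 0 < t → Summable fun i => |lam i| ^ a * Real.exp (p * lam i * t)) ∧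
    (2 < p → Summable fun i => 1 / |lam i| ^ (2 * a / (p - 2))) ∧
    0 < γ ∧ γ ≤ 1 ∧
    ∀ i, (∫⁻ t in Ioi (0 : ℝ), ENNReal.ofReal (Real.exp (-q * t)) *
      ∫⁻ y, ENNReal.ofReal (|inner ℝ y (e i)| ^ γ) ∂(μ t : Measure H)) < ∞

end Mehler

/-- The weak topology `τ_w` of `H`: the coarsest one making all continuous linear functionals
continuous. -/
@[reducible] noncomputable def weakTopology (H : Type*) [NormedAddCommGroup H] [InnerProductSpace ℝ H] :
    TopologicalSpace H :=
  TopologicalSpace.induced (toWeakSpace ℝ H) inferInstance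

end MehlerWeak

/-!
For every generalized Mehler semigroup closed balls are weakly compact, so the topological half of
the statement only needs a Hausdorff `𝓤`-topology that is coarser than the weak topology on balls.
The potentials `U_1 (1 + cos⟨·, d_n⟩)` and `U_1 (1 + sin⟨·, d_n⟩)` along a dense sequence `(d_n)`
generate one (`trigTopology`). They are weakly continuous on balls by dominated convergence, weakly
compact sets being metrizable (`induced_weakTopology_le_trigTopology`). They separate probability
measures (`ext_of_trig_potentials`): trigonometric functions determine the measure `ν U_1`, the
resolvent equation then gives all `ν U_α` with `α > 1`, and `α U_α f → f` recovers `ν`. Applied to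
Dirac measures this also gives the Hausdorff property.

The nest property rests on `isNest_closedBall`: if `v` is excessive and `v ≥ L` off a ball, then the
balayage of `1` on the complement of the ball is at most `v / L`. It suffices to have, for every
point `x`, an excessive function that is finite at `x` and has norm-bounded sublevel sets; it may
depend on `x`. Potentials `U_β f` are excessive (`isExcessive_mehlerResolvent`).

* If the generator is bounded, take `f = φ(‖·‖)` with `φ` subadditive and tending to infinity so
  slowly that the potential is finite at `x` and at `0` (`exists_subadditive_potential`); no moment
  of `μ_t` is needed. As `‖T_t z‖ ≥ ‖z‖ / 2` for small `t`, subadditivity makes `U_β f` large where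
  `‖z‖` is large (`coercive_potential_norm`).
* Under `(H_{A,μ})` the semigroup is diagonal, `⟨T_t z, e_i⟩ = e^{λ_i t} ⟨z, e_i⟩`, and the same
  function controls each single coordinate. For the tail add the energy
  `∑ |λ_i|^{1+a} ((|⟨z, e_i⟩| - |⟨x, e_i⟩|)⁺ ^ p ∧ 1)` (`truncEnergy`). Since the orbit of `x` never
  exceeds the thresholds `|⟨x, e_i⟩|` in the coordinates with `λ_i < 0`, its potential at `x` is at
  most the series in condition (ii), for every `x ∈ H`. The potential at `z` dominates
  `∑ |λ_i|^a (w_i ^ p ∧ 1)`, where `w_i` is the excess of `|⟨z, e_i⟩| / e` over the threshold, and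
  Hölder's inequality with the third series of (ii) bounds `∑ w_i²` (`exists_norm_le_of_energy`).
-/

namespace MehlerWeak

open scoped NNReal BoundedContinuousFunction

/-! ### Measurability and the semigroup property -/

section Semigroup

variable {H : Type*} [NormedAddCommGroup H] [InnerProductSpace ℝ H]
  {T : ℝ → H →L[ℝ] H}

theorem IsC0Semigroup.continuous_max (hT : IsC0Semigroup T) (x : H) :
    Continuous fun t : ℝ => T (max t 0) x :=
  (hT.continuousOn x).comp_continuous (by fun_prop) fun t => le_max_right t 0

theorem IsC0Semigroup.tendsto_zero (hT : IsC0Semigroup T) (x : H) :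
    Tendsto (fun t => T t x) (𝓝[>] 0) (𝓝 x) := by
  have h := (hT.continuousOn x 0 self_mem_Ici).mono Ioi_subset_Ici_self
  simpa [ContinuousWithinAt, hT.zero] using h

variable [MeasurableSpace H] [BorelSpace H]

theorem IsC0Semigroup.measurable_uncurry (hT : IsC0Semigroup T) :
    Measurable fun p : ℝ × H => T (max p.1 0) p.2 :=
  measurable_uncurry_of_continuous_of_measurable (u := fun (t : ℝ) (x : H) => T (max t 0) x)
    hT.continuous_max fun t => (T (max t 0)).continuous.measurable

variable {μ : ℝ → ProbabilityMeasure H} [SecondCountableTopology H]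

/-- The law of `T_t x + y` under `μ_t(dy)`, that is, the transition probability `P_t(x, ·)`. -/
noncomputable def transitionLaw (T : ℝ → H →L[ℝ] H) (μ : ℝ → ProbabilityMeasure H) (t : ℝ)
    (x : H) : ProbabilityMeasure H :=
  ((diracProba (T t x)).prod (μ t)).map (f := fun p : H × H => p.1 + p.2) (by fun_prop)

theorem lintegral_transitionLaw (t : ℝ) (x : H) {f : H → ℝ≥0∞} (hf : Measurable f) :
    ∫⁻ z, f z ∂(transitionLaw T μ t x : Measure H) = mehlerSemigroup T μ t f x := by
  rw [transitionLaw, ProbabilityMeasure.toMeasure_map,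
    lintegral_map hf (by fun_prop), ProbabilityMeasure.toMeasure_prod,
    lintegral_prod _ (by fun_prop)]
  simp only [diracProba, ProbabilityMeasure.coe_mk, mehlerSemigroup]
  rw [lintegral_dirac' _ (by fun_prop)]

theorem tendsto_transitionLaw (hT : IsC0Semigroup T) (hμ : IsMehlerFamily T μ) (x : H) :
    Tendsto (fun t => transitionLaw T μ t x) (𝓝[>] 0) (𝓝 (diracProba x)) := by
  have h1 : Tendsto (fun t => diracProba (T t x)) (𝓝[>] 0) (𝓝 (diracProba x)) :=
    (continuous_diracProba.tendsto x).comp (hT.tendsto_zero x)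
  have h2 := (ProbabilityMeasure.continuous_prod (α := H) (β := H)).tendsto
    (diracProba x, μ 0) |>.comp (h1.prodMk_nhds hμ.tendsto)
  have h3 := ProbabilityMeasure.tendsto_map_of_tendsto_of_continuous _ _ h2
    (f := fun p : H × H => p.1 + p.2) (by fun_prop)
  convert h3 using 2
  · rfl
  apply ProbabilityMeasure.toMeasure_injective
  rw [ProbabilityMeasure.toMeasure_map, ProbabilityMeasure.toMeasure_prod, hμ.zero]
  simp [diracProba, Measure.dirac_prod_dirac, Measure.map_dirac]

theorem tendsto_mehlerSemigroup (hT : IsC0Semigroup T) (hμ : IsMehlerFamily T μ) (x : H)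
    (f : H →ᵇ ℝ≥0) :
    Tendsto (fun t => mehlerSemigroup T μ t (fun z => f z) x) (𝓝[>] 0) (𝓝 (f x)) := by
  have h := (ProbabilityMeasure.tendsto_iff_forall_lintegral_tendsto.1
    (tendsto_transitionLaw hT hμ x)) f
  have hf : Measurable fun z => (f z : ℝ≥0∞) := f.continuous.measurable.coe_nnreal_ennreal
  simpa only [lintegral_transitionLaw _ _ hf, diracProba, ProbabilityMeasure.coe_mk,
    lintegral_dirac' _ hf] using h

/-- The family `(μ_t)` is weakly right continuous: `μ_{s+h} = (μ_h ∘ T_s⁻¹) ∗ μ_s` and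
`μ_h → δ_0`. -/
theorem IsMehlerFamily.tendsto_right (hμ : IsMehlerFamily T μ)
    {s : ℝ} (hs : 0 ≤ s) : Tendsto μ (𝓝[>] s) (𝓝 (μ s)) := by
  have h0 : Tendsto (fun h => μ (h + s)) (𝓝[>] 0) (𝓝 (μ s)) := by
    have h1 := ProbabilityMeasure.tendsto_map_of_tendsto_of_continuous _ _ hμ.tendsto
      (f := fun x => T s x) (T s).continuous
    have h2 := (ProbabilityMeasure.continuous_prod (α := H) (β := H)).tendsto
      (_, μ s) |>.comp (h1.prodMk_nhds tendsto_const_nhds)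
    have h3 := ProbabilityMeasure.tendsto_map_of_tendsto_of_continuous _ _ h2
      (f := fun p : H × H => p.1 + p.2) (by fun_prop)
    have key : ∀ h : ℝ, 0 ≤ h → μ (h + s) = (((μ h).map (f := fun x => T s x)
        (T s).continuous.aemeasurable).prod (μ s)).map (f := fun p : H × H => p.1 + p.2)
        (by fun_prop) := by
      intro h hh
      apply ProbabilityMeasure.toMeasure_injective
      rw [ProbabilityMeasure.toMeasure_map, ProbabilityMeasure.toMeasure_prod,
        ProbabilityMeasure.toMeasure_map, hμ.add s h hs hh, Measure.conv]
    have h4 := key 0 le_rfl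
    rw [zero_add] at h4
    rw [h4]
    refine h3.congr' ?_
    filter_upwards [self_mem_nhdsWithin] with h hh
    exact (key h (le_of_lt hh)).symm
  have h5 : Tendsto (fun t => t - s) (𝓝[>] s) (𝓝[>] 0) := by
    refine tendsto_nhdsWithin_iff.2 ⟨?_, ?_⟩
    · have : Tendsto (fun t : ℝ => t - s) (𝓝 s) (𝓝 (s - s)) := by
        exact (continuous_id.sub continuous_const).tendsto s
      rw [sub_self] at this
      exact this.mono_left nhdsWithin_le_nhds
    · filter_upwards [self_mem_nhdsWithin] with t ht
      exact sub_pos.2 (mem_Ioi.1 ht)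
  simpa [Function.comp_def] using h0.comp h5

/-- A function on `[0, ∞)` that is right continuous is Borel measurable: it is the limit of the
step functions obtained by evaluating at `(⌊n t⌋ + 1) / n > t`. -/
theorem measurable_of_tendsto_right {g : ℝ → ℝ≥0∞}
    (hg : ∀ s, 0 ≤ s → Tendsto g (𝓝[>] s) (𝓝 (g s))) : Measurable fun t => g (max t 0) := by
  refine measurable_of_tendsto_metrizable
    (f := fun (n : ℕ) (t : ℝ) => g ((⌊((n : ℝ) + 1) * max t 0⌋₊ + 1 : ℝ) / ((n : ℝ) + 1))) ?_ ?_
  · intro n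
    have h1 : Measurable fun k : ℕ => g (((k : ℝ) + 1) / ((n : ℝ) + 1)) := measurable_from_nat
    exact h1.comp (Nat.measurable_floor.comp (by fun_prop))
  · refine tendsto_pi_nhds.2 fun t => (hg _ (le_max_right t 0)).comp ?_
    set s := max t 0 with hs
    have hs0 : 0 ≤ s := le_max_right t 0
    have hpos : ∀ n : ℕ, (0 : ℝ) < (n : ℝ) + 1 := fun n => by positivity
    have hgt : ∀ n : ℕ, s < (⌊((n : ℝ) + 1) * s⌋₊ + 1 : ℝ) / ((n : ℝ) + 1) := fun n => by
      rw [lt_div_iff₀ (hpos n), mul_comm]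
      exact Nat.lt_floor_add_one _
    refine tendsto_nhdsWithin_iff.2 ⟨?_, Eventually.of_forall fun n => hgt n⟩
    have hlim : Tendsto (fun n : ℕ => s + 1 / ((n : ℝ) + 1)) atTop (𝓝 s) := by
      simpa using tendsto_one_div_add_atTop_nhds_zero_nat.const_add s
    refine tendsto_of_tendsto_of_tendsto_of_le_of_le tendsto_const_nhds hlim
      (fun n => (hgt n).le) fun n => ?_
    show _ / _ ≤ s + 1 / ((n : ℝ) + 1)
    rw [div_le_iff₀ (hpos n), add_mul _ _ ((n : ℝ) + 1), one_div,
      inv_mul_cancel₀ (hpos n).ne', mul_comm s]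
    have := Nat.floor_le (mul_nonneg (hpos n).le hs0)
    linarith

theorem IsMehlerFamily.measurable (hμ : IsMehlerFamily T μ) :
    Measurable fun t : ℝ => (μ (max t 0) : Measure H) := by
  refine Measurable.measure_of_isPiSystem_of_isProbabilityMeasure
    (S := {F | IsClosed F}) ?_ isPiSystem_isClosed ?_
  · rw [BorelSpace.measurable_eq (α := H), borel_eq_generateFrom_isClosed]
  · intro F hF
    have hF : IsClosed F := hF
    refine measurable_of_tendsto_metrizable
      (f := fun n t => ∫⁻ x, (hF.apprSeq n x : ℝ≥0∞) ∂(μ (max t 0) : Measure H)) ?_ ?_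
    · intro n
      refine measurable_of_tendsto_right
        (g := fun t => ∫⁻ x, (hF.apprSeq n x : ℝ≥0∞) ∂(μ t : Measure H)) fun s hs => ?_
      exact (ProbabilityMeasure.tendsto_iff_forall_lintegral_tendsto.1 (hμ.tendsto_right hs)) _
    · exact tendsto_pi_nhds.2 fun t => HasOuterApproxClosed.tendsto_lintegral_apprSeq hF _

theorem measurable_mehlerSemigroup (hT : IsC0Semigroup T) (hμ : IsMehlerFamily T μ)
    {f : H → ℝ≥0∞} (hf : Measurable f) :
    Measurable fun p : ℝ × H => mehlerSemigroup T μ (max p.1 0) f p.2 := by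
  let κ : ProbabilityTheory.Kernel (ℝ × H) H :=
    ⟨fun p => (μ (max p.1 0) : Measure H), hμ.measurable.comp measurable_fst⟩
  have : ProbabilityTheory.IsMarkovKernel κ := ⟨fun p => by
    show IsProbabilityMeasure (μ (max p.1 0) : Measure H)
    infer_instance⟩
  have h : Measurable fun q : (ℝ × H) × H => f (T (max q.1.1 0) q.1.2 + q.2) :=
    hf.comp ((hT.measurable_uncurry.comp measurable_fst).add measurable_snd)
  exact h.lintegral_kernel_prod_right' (κ := κ)

theorem mehlerSemigroup_comp (hT : IsC0Semigroup T) (hμ : IsMehlerFamily T μ) {s t : ℝ}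
    (hs : 0 ≤ s) (ht : 0 ≤ t) {f : H → ℝ≥0∞} (hf : Measurable f) (x : H) :
    mehlerSemigroup T μ s (mehlerSemigroup T μ t f) x = mehlerSemigroup T μ (s + t) f x := by
  simp only [mehlerSemigroup]
  rw [hμ.add t s ht hs, Measure.lintegral_conv (by fun_prop), lintegral_map]
  · refine lintegral_congr fun y => lintegral_congr fun z => ?_
    rw [map_add, add_comm s t, hT.add t s ht hs, ContinuousLinearMap.comp_apply, add_assoc]
  · exact Measurable.lintegral_prod_right' (f := fun p : H × H => f (T (s + t) x + (p.1 + p.2)))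
      (by fun_prop)
  · exact (T t).continuous.measurable

end Semigroup

/-! ### Exponential weights on the half-line -/

section Laplace

/-- The exponential weight `e^{-at}` as an extended nonnegative real. -/
noncomputable abbrev expWeight (a t : ℝ) : ℝ≥0∞ := ENNReal.ofReal (Real.exp (-a * t))

theorem measurable_expWeight (a : ℝ) : Measurable (expWeight a) := by
  unfold expWeight; fun_prop

theorem expWeight_add (a s t : ℝ) : expWeight a (s + t) = expWeight a s * expWeight a t := by
  rw [expWeight, ← ENNReal.ofReal_mul (Real.exp_pos _).le, ← Real.exp_add]
  ring_nf

theorem expWeight_add_left (a b t : ℝ) :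
    expWeight (a + b) t = expWeight a t * expWeight b t := by
  rw [expWeight, ← ENNReal.ofReal_mul (Real.exp_pos _).le, ← Real.exp_add]
  ring_nf

theorem lintegral_Ioi_expWeight {a : ℝ} (ha : 0 < a) :
    ∫⁻ t in Ioi (0 : ℝ), expWeight a t = (ENNReal.ofReal a)⁻¹ := by
  have h1 : IntegrableOn (fun t : ℝ => Real.exp (-a * t)) (Ioi 0) :=
    integrableOn_exp_mul_Ioi (by linarith) 0
  rw [← ofReal_integral_eq_lintegral_ofReal h1
    (Eventually.of_forall fun t => (Real.exp_pos _).le), integral_exp_mul_Ioi (by linarith),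
    ← ENNReal.ofReal_inv_of_pos ha]
  congr 1
  simp [neg_div_neg_eq]

theorem lintegral_Ioo_expWeight {a r : ℝ} (ha : 0 < a) (hr : 0 < r) :
    ENNReal.ofReal a * ∫⁻ t in Ioo 0 r, expWeight a t =
      ENNReal.ofReal (1 - Real.exp (-a * r)) := by
  rw [setLIntegral_congr Ioo_ae_eq_Ioc, ← ofReal_integral_eq_lintegral_ofReal
    (Continuous.integrableOn_Ioc (by fun_prop))
    (Eventually.of_forall fun t => (Real.exp_pos _).le), ← ENNReal.ofReal_mul ha.le,
    ← intervalIntegral.integral_of_le hr.le, ← intervalIntegral.integral_const_mul,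
    intervalIntegral.integral_eq_sub_of_hasDerivAt (f := fun t => -Real.exp (-a * t))]
  · congr 1
    simp
    ring
  · intro t _
    have h := (((hasDerivAt_id t).const_mul (-a)).exp).neg
    convert h using 1
    · ext; simp
    · simp [mul_comm]
  · exact (Continuous.intervalIntegrable (by fun_prop) _ _)

theorem setLIntegral_Ioi_comp_add (g : ℝ → ℝ≥0∞) (s : ℝ) :
    ∫⁻ t in Ioi (0 : ℝ), g (s + t) = ∫⁻ r in Ioi s, g r := by
  have h := (measurePreserving_add_left (volume : Measure ℝ) s).setLIntegral_comp_preimage_emb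
    (measurableEmbedding_addLeft s) g (Ioi s)
  rw [← h]
  congr 2
  ext t
  simp

/-- Integration by parts in Tonelli form: the measure `γ e^{-γ s} ds` of `(0, r)` is
`1 - e^{-γ r}`. -/
theorem lintegral_expWeight_mul_tail {γ : ℝ} (hγ : 0 < γ) {g : ℝ → ℝ≥0∞} (hg : Measurable g) :
    ENNReal.ofReal γ * ∫⁻ s in Ioi (0 : ℝ), expWeight γ s * ∫⁻ r in Ioi s, g r =
      ∫⁻ r in Ioi (0 : ℝ), ENNReal.ofReal (1 - Real.exp (-γ * r)) * g r := by
  have hmeas : Measurable fun p : ℝ × ℝ => {p : ℝ × ℝ | p.1 < p.2}.indicator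
      (fun p => expWeight γ p.1 * g p.2) p :=
    (((measurable_expWeight γ).comp measurable_fst).mul (hg.comp measurable_snd)).indicator
      (measurableSet_lt measurable_fst measurable_snd)
  have h1 : ∀ s ∈ Ioi (0 : ℝ), expWeight γ s * ∫⁻ r in Ioi s, g r =
      ∫⁻ r in Ioi (0 : ℝ), {p : ℝ × ℝ | p.1 < p.2}.indicator
        (fun p => expWeight γ p.1 * g p.2) (s, r) := by
    intro s hs
    rw [← lintegral_const_mul _ hg, ← lintegral_indicator measurableSet_Ioi,
      ← lintegral_indicator measurableSet_Ioi]
    refine lintegral_congr fun r => ?_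
    by_cases hr : s < r
    · simp [indicator, hr, (mem_Ioi.1 hs).trans hr]
    · simp [indicator, hr]
  have h2 : ∀ r ∈ Ioi (0 : ℝ), ENNReal.ofReal (1 - Real.exp (-γ * r)) * g r =
      ENNReal.ofReal γ * ∫⁻ s in Ioi (0 : ℝ), {p : ℝ × ℝ | p.1 < p.2}.indicator
        (fun p => expWeight γ p.1 * g p.2) (s, r) := by
    intro r hr
    rw [← lintegral_Ioo_expWeight hγ hr, mul_assoc,
      ← lintegral_mul_const _ (measurable_expWeight γ), ← lintegral_indicator measurableSet_Ioi,
      ← lintegral_indicator measurableSet_Ioo]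
    congr 1
    refine lintegral_congr fun s => ?_
    by_cases h0 : 0 < s <;> by_cases hs : s < r <;> simp [indicator, h0, hs]
  rw [setLIntegral_congr_fun measurableSet_Ioi h1, setLIntegral_congr_fun measurableSet_Ioi h2,
    lintegral_const_mul _ hmeas.lintegral_prod_left',
    lintegral_lintegral_swap hmeas.aemeasurable]

end Laplace

/-! ### The resolvent equation and excessive potentials -/

section Resolvent

variable {H : Type*} [NormedAddCommGroup H] [InnerProductSpace ℝ H]
  {T : ℝ → H →L[ℝ] H} [MeasurableSpace H] {μ : ℝ → ProbabilityMeasure H}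

theorem mehlerSemigroup_mono {f g : H → ℝ≥0∞} (h : ∀ x, f x ≤ g x) (t : ℝ) (x : H) :
    mehlerSemigroup T μ t f x ≤ mehlerSemigroup T μ t g x :=
  lintegral_mono fun _ => h _

theorem mehlerResolvent_mono {f g : H → ℝ≥0∞} (h : ∀ x, f x ≤ g x) (α : ℝ) (x : H) :
    mehlerResolvent T μ α f x ≤ mehlerResolvent T μ α g x :=
  lintegral_mono fun _ => mul_le_mul_right (mehlerSemigroup_mono h _ _) _

theorem mehlerSemigroup_const (c : ℝ≥0∞) (t : ℝ) (x : H) :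
    mehlerSemigroup T μ t (fun _ => c) x = c := by
  simp [mehlerSemigroup]

theorem mehlerResolvent_const {α : ℝ} (hα : 0 < α) (c : ℝ≥0∞) (x : H) :
    mehlerResolvent T μ α (fun _ => c) x = (ENNReal.ofReal α)⁻¹ * c := by
  simp only [mehlerResolvent, mehlerSemigroup_const]
  rw [lintegral_mul_const _ (measurable_expWeight α), lintegral_Ioi_expWeight hα]

theorem mehlerResolvent_const_mul (α : ℝ) {c : ℝ≥0∞} (hc : c ≠ ∞)
    (f : H → ℝ≥0∞) (x : H) :
    mehlerResolvent T μ α (fun z => c * f z) x = c * mehlerResolvent T μ α f x := by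
  simp only [mehlerResolvent, mehlerSemigroup]
  simp_rw [lintegral_const_mul' c _ hc, mul_left_comm _ c]
  rw [lintegral_const_mul' c _ hc]

theorem mehlerResolvent_eq_max (α : ℝ) (f : H → ℝ≥0∞) (x : H) :
    mehlerResolvent T μ α f x =
      ∫⁻ t in Ioi (0 : ℝ), expWeight α t * mehlerSemigroup T μ (max t 0) f x :=
  setLIntegral_congr_fun measurableSet_Ioi fun t ht => by
    rw [max_eq_left (le_of_lt ht)]

variable [BorelSpace H] [SecondCountableTopology H]
  (hT : IsC0Semigroup T) (hμ : IsMehlerFamily T μ)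
include hT hμ

theorem measurable_mehlerSemigroup_time {f : H → ℝ≥0∞} (hf : Measurable f) (x : H) :
    Measurable fun t : ℝ => mehlerSemigroup T μ (max t 0) f x :=
  (measurable_mehlerSemigroup hT hμ hf).comp (measurable_id.prodMk measurable_const)

theorem measurable_mehlerResolvent (α : ℝ) {f : H → ℝ≥0∞} (hf : Measurable f) :
    Measurable (mehlerResolvent T μ α f) := by
  have h : Measurable fun p : H × ℝ =>
      expWeight α p.2 * mehlerSemigroup T μ (max p.2 0) f p.1 :=
    ((measurable_expWeight α).comp measurable_snd).mul
      ((measurable_mehlerSemigroup hT hμ hf).comp measurable_swap)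
  have h2 : mehlerResolvent T μ α f = fun x =>
      ∫⁻ t in Ioi (0 : ℝ), expWeight α t * mehlerSemigroup T μ (max t 0) f x :=
    funext fun x => mehlerResolvent_eq_max α f x
  rw [h2]
  exact h.lintegral_prod_right'

theorem mehlerResolvent_add (α : ℝ) {f g : H → ℝ≥0∞} (hf : Measurable f)
    (x : H) : mehlerResolvent T μ α (fun z => f z + g z) x =
      mehlerResolvent T μ α f x + mehlerResolvent T μ α g x := by
  rw [mehlerResolvent_eq_max α f, mehlerResolvent, mehlerResolvent, ← lintegral_add_left]
  · refine setLIntegral_congr_fun measurableSet_Ioi fun t ht => ?_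
    simp only [mehlerSemigroup, max_eq_left (le_of_lt (mem_Ioi.1 ht)), expWeight]
    rw [← mul_add, ← lintegral_add_left (by fun_prop)]
  · exact (measurable_expWeight α).mul (measurable_mehlerSemigroup_time hT hμ hf x)

theorem mehlerSemigroup_mehlerResolvent {s : ℝ} (hs : 0 ≤ s) (α : ℝ) {f : H → ℝ≥0∞}
    (hf : Measurable f) (x : H) :
    mehlerSemigroup T μ s (mehlerResolvent T μ α f) x =
      ∫⁻ t in Ioi (0 : ℝ), expWeight α t * mehlerSemigroup T μ (s + t) f x := by
  have hm : Measurable fun p : H × ℝ =>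
      expWeight α p.2 * mehlerSemigroup T μ (max p.2 0) f (T s x + p.1) :=
    ((measurable_expWeight α).comp measurable_snd).mul
      ((measurable_mehlerSemigroup hT hμ hf).comp
        (measurable_snd.prodMk (measurable_const.add measurable_fst)))
  simp only [mehlerSemigroup.eq_1 T μ s, mehlerResolvent_eq_max]
  rw [lintegral_lintegral_swap hm.aemeasurable]
  refine setLIntegral_congr_fun measurableSet_Ioi fun t ht => ?_
  have ht : 0 < t := ht
  simp only [max_eq_left ht.le]
  rw [lintegral_const_mul' _ _ ENNReal.ofReal_ne_top, ← mehlerSemigroup_comp hT hμ hs ht.le hf,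
    mehlerSemigroup.eq_1 T μ s]

/-- The integrated form `γ U_{γ+β} U_β f = ∫ (1 - e^{-γ r}) e^{-β r} P_r f dr` of the resolvent
equation, valid also where `U_β f` is infinite. -/
theorem mul_mehlerResolvent_mehlerResolvent (β : ℝ) {γ : ℝ} (hγ : 0 < γ) {f : H → ℝ≥0∞}
    (hf : Measurable f) (x : H) :
    ENNReal.ofReal γ * mehlerResolvent T μ (γ + β) (mehlerResolvent T μ β f) x =
      ∫⁻ r in Ioi (0 : ℝ), ENNReal.ofReal (1 - Real.exp (-γ * r)) *
        (expWeight β r * mehlerSemigroup T μ (max r 0) f x) := by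
  have hm : Measurable fun r => expWeight β r * mehlerSemigroup T μ (max r 0) f x :=
    (measurable_expWeight β).mul (measurable_mehlerSemigroup_time hT hμ hf x)
  rw [← lintegral_expWeight_mul_tail hγ hm, mehlerResolvent]
  congr 1
  refine setLIntegral_congr_fun measurableSet_Ioi fun s hs => ?_
  have hs : 0 < s := hs
  rw [mehlerSemigroup_mehlerResolvent hT hμ hs.le β hf, ← setLIntegral_Ioi_comp_add
    (fun r => expWeight β r * mehlerSemigroup T μ (max r 0) f x) s,
    ← expWeight, expWeight_add_left, mul_assoc, ← lintegral_const_mul' _ _ ENNReal.ofReal_ne_top]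
  congr 1
  refine setLIntegral_congr_fun measurableSet_Ioi fun t ht => ?_
  have ht : 0 < t := ht
  simp only [max_eq_left (add_pos hs ht).le]
  rw [expWeight_add, mul_assoc]

theorem mehlerResolvent_comm (a b : ℝ) {f : H → ℝ≥0∞} (hf : Measurable f) (x : H) :
    mehlerResolvent T μ a (mehlerResolvent T μ b f) x =
      mehlerResolvent T μ b (mehlerResolvent T μ a f) x := by
  have key : ∀ a b : ℝ, mehlerResolvent T μ a (mehlerResolvent T μ b f) x =
      ∫⁻ s in Ioi (0 : ℝ), ∫⁻ t in Ioi (0 : ℝ),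
        expWeight a s * (expWeight b t * mehlerSemigroup T μ (max (s + t) 0) f x) := by
    intro a b
    rw [mehlerResolvent]
    refine setLIntegral_congr_fun measurableSet_Ioi fun s hs => ?_
    have hs : 0 < s := hs
    rw [mehlerSemigroup_mehlerResolvent hT hμ hs.le b hf, ← expWeight,
      ← lintegral_const_mul' _ _ ENNReal.ofReal_ne_top]
    refine setLIntegral_congr_fun measurableSet_Ioi fun t ht => ?_
    simp only [max_eq_left (add_pos hs (mem_Ioi.1 ht)).le]
  have hm : Measurable fun p : ℝ × ℝ =>
      expWeight a p.1 * (expWeight b p.2 * mehlerSemigroup T μ (max (p.1 + p.2) 0) f x) :=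
    ((measurable_expWeight a).comp measurable_fst).mul
      (((measurable_expWeight b).comp measurable_snd).mul
        ((measurable_mehlerSemigroup_time hT hμ hf x).comp (measurable_fst.add measurable_snd)))
  rw [key a b, key b a, lintegral_lintegral_swap hm.aemeasurable]
  refine lintegral_congr fun t => lintegral_congr fun s => ?_
  rw [mul_left_comm, add_comm]

theorem resolvent_equation (β : ℝ) {γ : ℝ} (hγ : 0 < γ) {f : H → ℝ≥0∞}
    (hf : Measurable f) (x : H) :
    mehlerResolvent T μ (γ + β) f x +
      ENNReal.ofReal γ * mehlerResolvent T μ (γ + β) (mehlerResolvent T μ β f) x =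
        mehlerResolvent T μ β f x := by
  rw [mul_mehlerResolvent_mehlerResolvent hT hμ β hγ hf, mehlerResolvent_eq_max,
    mehlerResolvent_eq_max, ← lintegral_add_left]
  · refine setLIntegral_congr_fun measurableSet_Ioi fun r hr => ?_
    have h1 : Real.exp (-γ * r) ≤ 1 := by
      rw [Real.exp_le_one_iff]
      nlinarith [mem_Ioi.1 hr]
    rw [expWeight_add_left, mul_assoc, ← add_mul, ← ENNReal.ofReal_add (Real.exp_pos _).le
      (by linarith)]
    simp
  · exact (measurable_expWeight _).mul (measurable_mehlerSemigroup_time hT hμ hf x)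

theorem isExcessive_mehlerResolvent (β : ℝ) {f : H → ℝ≥0∞} (hf : Measurable f) :
    IsExcessive (mehlerResolvent T μ) β (mehlerResolvent T μ β f) := by
  have hle : ∀ γ : ℝ, 0 < γ → ∀ x, ENNReal.ofReal γ *
      mehlerResolvent T μ (γ + β) (mehlerResolvent T μ β f) x ≤ mehlerResolvent T μ β f x :=
    fun γ hγ x => by
      conv_rhs => rw [← resolvent_equation hT hμ β hγ hf x]
      exact le_add_self
  refine ⟨measurable_mehlerResolvent hT hμ β hf, hle, fun x => le_antisymm
    (iSup₂_le fun γ hγ => hle γ hγ x) ?_⟩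
  have hm : Measurable fun r => expWeight β r * mehlerSemigroup T μ (max r 0) f x :=
    (measurable_expWeight β).mul (measurable_mehlerSemigroup_time hT hμ hf x)
  have hlim : ∀ r ∈ Ioi (0 : ℝ), (⨆ n : ℕ, ENNReal.ofReal (1 - Real.exp (-((n : ℝ) + 1) * r)) *
      (expWeight β r * mehlerSemigroup T μ (max r 0) f x)) =
        expWeight β r * mehlerSemigroup T μ (max r 0) f x := by
    intro r hr
    rw [← ENNReal.iSup_mul]
    have h1 : (⨆ n : ℕ, ENNReal.ofReal (1 - Real.exp (-((n : ℝ) + 1) * r))) = 1 := by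
      refine le_antisymm (iSup_le fun n => ?_) ?_
      · rw [ENNReal.ofReal_le_one]
        linarith [Real.exp_pos (-((n : ℝ) + 1) * r)]
      · have ht : Tendsto (fun n : ℕ => ENNReal.ofReal (1 - Real.exp (-((n : ℝ) + 1) * r))) atTop
            (𝓝 (ENNReal.ofReal (1 - 0))) := by
          refine ENNReal.tendsto_ofReal (tendsto_const_nhds.sub ?_)
          refine Real.tendsto_exp_atBot.comp ?_
          simp_rw [neg_mul]
          exact tendsto_neg_atTop_atBot.comp
            ((tendsto_natCast_atTop_atTop.atTop_add tendsto_const_nhds).atTop_mul_const hr)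
        simp only [sub_zero, ENNReal.ofReal_one] at ht
        exact le_of_tendsto' ht fun n => le_iSup
          (fun n : ℕ => ENNReal.ofReal (1 - Real.exp (-((n : ℝ) + 1) * r))) n
    rw [h1, one_mul]
  rw [mehlerResolvent_eq_max, ← setLIntegral_congr_fun measurableSet_Ioi hlim, lintegral_iSup']
  · refine iSup_le fun n => ?_
    refine le_trans (le_of_eq ?_) (le_iSup₂ (f := fun (γ : ℝ) (_ : 0 < γ) => ENNReal.ofReal γ *
      mehlerResolvent T μ (γ + β) (mehlerResolvent T μ β f) x) ((n : ℝ) + 1) (by positivity))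
    exact (mul_mehlerResolvent_mehlerResolvent hT hμ β (by positivity) hf x).symm
  · exact fun n => (Measurable.mul (by fun_prop) hm).aemeasurable
  · filter_upwards [ae_restrict_mem measurableSet_Ioi] with r hr m n hmn
    have hr : 0 < r := hr
    have hmn' : (m : ℝ) ≤ n := by exact_mod_cast hmn
    dsimp only
    gcongr

end Resolvent

/-! ### Closed balls as a nest -/

section Nest

variable {H : Type*} [NormedAddCommGroup H] [InnerProductSpace ℝ H]
  {T : ℝ → H →L[ℝ] H} [MeasurableSpace H] {μ : ℝ → ProbabilityMeasure H}

theorem isExcessive_const {β : ℝ} (hβ : 0 ≤ β) (c : ℝ≥0∞) :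
    IsExcessive (mehlerResolvent T μ) β fun _ => c := by
  have hU : ∀ γ : ℝ, 0 < γ → ∀ x, ENNReal.ofReal γ * mehlerResolvent T μ (γ + β) (fun _ => c) x
      = ENNReal.ofReal (γ / (γ + β)) * c := by
    intro γ hγ x
    rw [mehlerResolvent_const (by linarith), ← mul_assoc, div_eq_mul_inv,
      ENNReal.ofReal_mul hγ.le, ENNReal.ofReal_inv_of_pos (by linarith)]
  have hle : ∀ γ : ℝ, 0 < γ → ENNReal.ofReal (γ / (γ + β)) * c ≤ c := by
    intro γ hγ
    refine mul_le_of_le_one_left' (ENNReal.ofReal_le_one.2 ?_)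
    rw [div_le_one (by linarith)]
    linarith
  refine ⟨measurable_const, fun γ hγ x => (hU γ hγ x).trans_le (hle γ hγ), fun x =>
    le_antisymm (iSup₂_le fun γ hγ => (hU γ hγ x).trans_le (hle γ hγ)) ?_⟩
  have h1 : (⨆ n : ℕ, ENNReal.ofReal (((n : ℝ) + 1) / ((n : ℝ) + 1 + β))) = 1 := by
    refine le_antisymm (iSup_le fun n => ENNReal.ofReal_le_one.2 ?_) ?_
    · rw [div_le_one (by positivity)]
      linarith
    · have hn : Tendsto (fun n : ℕ => (n : ℝ) + 1 + β) atTop atTop :=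
        (tendsto_natCast_atTop_atTop.atTop_add tendsto_const_nhds).atTop_add tendsto_const_nhds
      have ht : Tendsto (fun n : ℕ => ENNReal.ofReal (((n : ℝ) + 1) / ((n : ℝ) + 1 + β))) atTop
          (𝓝 (ENNReal.ofReal (1 - 0))) := by
        refine ENNReal.tendsto_ofReal
          ((tendsto_const_nhds.sub ((tendsto_const_nhds (x := β)).div_atTop hn)).congr fun n => ?_)
        field_simp
        ring
      simp only [sub_zero, ENNReal.ofReal_one] at ht
      exact le_of_tendsto' ht fun n => le_iSup
        (fun n : ℕ => ENNReal.ofReal (((n : ℝ) + 1) / ((n : ℝ) + 1 + β))) n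
  calc c = ⨆ n : ℕ, ENNReal.ofReal (((n : ℝ) + 1) / ((n : ℝ) + 1 + β)) * c := by
        rw [← ENNReal.iSup_mul, h1, one_mul]
    _ ≤ _ := iSup_le fun n => by
        rw [← hU _ (by positivity) x]
        exact le_iSup₂ (f := fun (γ : ℝ) (_ : 0 < γ) => ENNReal.ofReal γ *
          mehlerResolvent T μ (γ + β) (fun _ => c) x) ((n : ℝ) + 1) (by positivity)

/-- Domination principle for the balayage of the constant `1`: an excessive function that is at
least `L` on `D` bounds `B_β^D 1` after division by `L`. -/
theorem balayage_one_le {β : ℝ} {v : H → ℝ≥0∞}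
    (hv : IsExcessive (mehlerResolvent T μ) β v) {L : ℝ≥0∞} (hL : L ≠ 0) (hL' : L ≠ ∞)
    {D : Set H} (hD : ∀ z ∈ D, L ≤ v z) (x : H) :
    balayage (mehlerResolvent T μ) β D (fun _ => 1) x ≤ L⁻¹ * v x := by
  have hL1 : L⁻¹ ≠ ∞ := ENNReal.inv_ne_top.2 hL
  have hmul : ∀ γ : ℝ, ∀ x, ENNReal.ofReal γ *
      mehlerResolvent T μ (γ + β) (fun z => L⁻¹ * v z) x =
        L⁻¹ * (ENNReal.ofReal γ * mehlerResolvent T μ (γ + β) v x) := fun γ x => by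
    rw [mehlerResolvent_const_mul _ hL1, mul_left_comm]
  have hw : IsExcessive (mehlerResolvent T μ) β fun z => L⁻¹ * v z := by
    refine ⟨hv.measurable.const_mul _, fun γ hγ x => ?_, fun x => ?_⟩
    · rw [hmul]
      exact mul_le_mul_right (hv.supermedian γ hγ x) _
    · simp only [hmul]
      simp_rw [← ENNReal.mul_iSup L⁻¹]
      rw [hv.iSup_eq]
  have hred : ∀ z, reduced (mehlerResolvent T μ) β D (fun _ => 1) z ≤ L⁻¹ * v z := fun z =>
    iInf_le_of_le _ (iInf_le_of_le hw (iInf_le _ fun y hy => by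
      rw [← ENNReal.inv_mul_cancel hL hL']
      exact mul_le_mul_right (hD y hy) _))
  exact iSup₂_le fun γ hγ =>
    (mul_le_mul_right (mehlerResolvent_mono hred _ _) _).trans (hw.supermedian γ hγ x)

/-- Closed balls form a nest as soon as every point `x` admits an excessive function that is
finite at `x` and has norm-bounded sublevel sets; the function may depend on `x`. -/
theorem isNest_closedBall [BorelSpace H] {β : ℝ} (hβ : 0 < β)
    (h : ∀ x : H, ∃ v : H → ℝ≥0∞, IsExcessive (mehlerResolvent T μ) β v ∧ v x ≠ ∞ ∧
      ∀ L : ℝ≥0∞, L ≠ ∞ → ∃ R : ℝ, ∀ z, v z ≤ L → ‖z‖ ≤ R) :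
    IsNest (mehlerResolvent T μ) fun n : ℕ => Metric.closedBall (0 : H) ((n : ℝ) + 1) := by
  refine ⟨fun m n hmn => Metric.closedBall_subset_closedBall (by gcongr),
    fun n => measurableSet_closedBall, β, fun _ => 1, hβ, isExcessive_const hβ.le 1,
    fun _ => one_pos, ⟨1, ENNReal.one_lt_top, fun _ => le_rfl⟩, fun x => ?_⟩
  obtain ⟨v, hv, hvx, hcoer⟩ := h x
  refine ENNReal.tendsto_nhds_zero.2 fun ε hε => ?_
  set L : ℝ≥0∞ := v x / ε + 1 with hLdef
  have hL : L ≠ ∞ := ENNReal.add_ne_top.2 ⟨(ENNReal.div_lt_top hvx hε.ne').ne, ENNReal.one_ne_top⟩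
  have hL0 : L ≠ 0 := by simp [hLdef]
  obtain ⟨R, hR⟩ := hcoer L hL
  filter_upwards [tendsto_natCast_atTop_atTop.eventually_ge_atTop R] with n hn
  refine (balayage_one_le hv hL0 hL (fun z hz => ?_) x).trans ?_
  · by_contra hlt
    have := hR z (not_le.1 hlt).le
    simp only [mem_compl_iff, mem_closedBall_zero_iff, not_le] at hz
    linarith
  · rw [mul_comm, ← div_eq_mul_inv]
    refine ENNReal.div_le_of_le_mul ?_
    rcases eq_or_ne ε ∞ with rfl | hε'
    · rw [ENNReal.top_mul hL0]
      exact le_top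
    · rw [hLdef, mul_add, ENNReal.mul_div_cancel hε.ne' hε']
      exact le_self_add

end Nest

/-! ### Slowly growing functions of the norm -/

section Moment

variable {H : Type*} [NormedAddCommGroup H] [MeasurableSpace H] [BorelSpace H]

/-- Every finite measure integrates some subadditive function of the norm that tends to
infinity, however slowly. -/
theorem exists_subadditive_moment (m : Measure H) [IsFiniteMeasure m] :
    ∃ φ : ℝ → ℝ≥0∞, Measurable φ ∧ Monotone φ ∧
      (∀ r s, 0 ≤ r → 0 ≤ s → φ (r + s) ≤ φ r + φ s) ∧
      (∀ L : ℝ≥0∞, L ≠ ∞ → ∃ R : ℝ, ∀ r, φ r ≤ L → r ≤ R) ∧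
      ∫⁻ z, φ ‖z‖ ∂m ≠ ∞ := by
  have hlim : Tendsto (fun n : ℕ => ∫⁻ z, ENNReal.ofReal (min 1 (‖z‖ / ((n : ℝ) + 1))) ∂m) atTop
      (𝓝 (∫⁻ _, 0 ∂m)) := by
    refine tendsto_lintegral_of_dominated_convergence (fun _ => 1) (fun n => by fun_prop)
      (fun n => Eventually.of_forall fun z => ?_) (by simp)
      (Eventually.of_forall fun z => ?_)
    · exact ENNReal.ofReal_le_one.2 (min_le_left _ _)
    · have h1 : Tendsto (fun n : ℕ => min 1 (‖z‖ / ((n : ℝ) + 1))) atTop (𝓝 (min 1 0)) :=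
        tendsto_const_nhds.min (tendsto_const_nhds.div_atTop
          (tendsto_natCast_atTop_atTop.atTop_add tendsto_const_nhds))
      simpa using ENNReal.tendsto_ofReal h1
  rw [lintegral_zero] at hlim
  have hex : ∀ k : ℕ, ∃ n : ℕ,
      ∫⁻ z, ENNReal.ofReal (min 1 (‖z‖ / ((n : ℝ) + 1))) ∂m ≤ 2⁻¹ ^ k := fun k =>
    ((ENNReal.tendsto_nhds_zero.1 hlim) (2⁻¹ ^ k)
      (ENNReal.pow_pos (by simp) k)).exists
  choose n hn using hex
  have hpos : ∀ k, (0 : ℝ) < (n k : ℝ) + 1 := fun k => by positivity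
  refine ⟨fun r => ∑' k, ENNReal.ofReal (min 1 (r / ((n k : ℝ) + 1))), by fun_prop, ?_, ?_, ?_, ?_⟩
  · intro r s hrs
    refine ENNReal.tsum_le_tsum fun k => ENNReal.ofReal_le_ofReal ?_
    gcongr
  · intro r s hr hs
    dsimp only
    rw [← ENNReal.tsum_add]
    refine ENNReal.tsum_le_tsum fun k => ?_
    have h1 : 0 ≤ r / ((n k : ℝ) + 1) := by positivity
    have h2 : 0 ≤ s / ((n k : ℝ) + 1) := by positivity
    rw [← ENNReal.ofReal_add (le_min zero_le_one h1) (le_min zero_le_one h2), add_div]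
    refine ENNReal.ofReal_le_ofReal ?_
    rcases le_total 1 (r / ((n k : ℝ) + 1)) with h3 | h3
    · rw [min_eq_left h3]
      exact (min_le_left _ _).trans (le_add_of_nonneg_right (le_min zero_le_one h2))
    rcases le_total 1 (s / ((n k : ℝ) + 1)) with h4 | h4
    · rw [min_eq_left h4]
      exact (min_le_left _ _).trans (le_add_of_nonneg_left (le_min zero_le_one h1))
    · rw [min_eq_right h3, min_eq_right h4]
      exact min_le_right _ _
  · intro L hL
    obtain ⟨N, hN⟩ := ENNReal.exists_nat_gt hL
    refine ⟨∑ k ∈ Finset.range N, ((n k : ℝ) + 1), fun r hr => ?_⟩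
    by_contra hlt
    rw [not_le] at hlt
    refine absurd hr (not_le.2 (hN.trans_le ?_))
    calc (N : ℝ≥0∞) = ∑ k ∈ Finset.range N, ENNReal.ofReal (min 1 (r / ((n k : ℝ) + 1))) := by
          rw [Finset.sum_congr rfl (g := fun _ => (1 : ℝ≥0∞)), Finset.sum_const]
          · simp
          · intro k hk
            have h1 : (n k : ℝ) + 1 ≤ r :=
              (Finset.single_le_sum (f := fun k => (n k : ℝ) + 1)
                (fun i _ => (hpos i).le) hk).trans hlt.le
            rw [min_eq_left ((one_le_div (hpos k)).2 h1), ENNReal.ofReal_one]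
      _ ≤ _ := ENNReal.sum_le_tsum _
  · rw [lintegral_tsum (fun k => by fun_prop)]
    refine ne_top_of_le_ne_top ?_ (ENNReal.tsum_le_tsum hn)
    rw [ENNReal.tsum_geometric]
    simp

end Moment

/-! ### Coercive potentials -/

section Lyapunov

variable {H : Type*} [NormedAddCommGroup H] [InnerProductSpace ℝ H]
  {T : ℝ → H →L[ℝ] H} [MeasurableSpace H] {μ : ℝ → ProbabilityMeasure H}
  [BorelSpace H] [SecondCountableTopology H]
  (hT : IsC0Semigroup T) (hμ : IsMehlerFamily T μ)
include hT hμ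

/-- The action `ν U_α` of the resolvent on measures. -/
theorem exists_measure_lintegral_resolvent (α : ℝ) (ν : Measure H) [SFinite ν] :
    ∃ m : Measure H, ∀ f : H → ℝ≥0∞, Measurable f →
      ∫⁻ z, f z ∂m = ∫⁻ x, mehlerResolvent T μ α f x ∂ν := by
  have hK : Measurable fun p : ℝ × H => (transitionLaw T μ (max p.1 0) p.2 : Measure H) := by
    refine Measure.measurable_of_measurable_coe _ fun s hs => ?_
    have h1 : Measurable (s.indicator (1 : H → ℝ≥0∞)) := measurable_one.indicator hs
    have h2 := measurable_mehlerSemigroup hT hμ h1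
    simp_rw [← lintegral_transitionLaw _ _ h1, lintegral_indicator_one hs] at h2
    exact h2
  refine ⟨(((volume.restrict (Ioi (0 : ℝ))).withDensity (expWeight α)).prod ν).bind
    (fun p => (transitionLaw T μ (max p.1 0) p.2 : Measure H)), fun f hf => ?_⟩
  rw [Measure.lintegral_bind hK.aemeasurable hf.aemeasurable]
  simp_rw [lintegral_transitionLaw _ _ hf]
  rw [lintegral_prod_symm _ (measurable_mehlerSemigroup hT hμ hf).aemeasurable]
  refine lintegral_congr fun x => ?_
  rw [lintegral_withDensity_eq_lintegral_mul _ (measurable_expWeight α)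
    (measurable_mehlerSemigroup_time hT hμ hf x), mehlerResolvent_eq_max]
  rfl

/-- If `ψ(a) ≤ c (ψ₁(a + y) + ψ₂(y))`, the integral of `ψ` along the orbit of `z` is controlled by
the potential of `ψ₁` at `z` and that of `ψ₂` at the origin. -/
theorem lintegral_orbit_le (β : ℝ) {ψ ψ₁ ψ₂ : H → ℝ≥0∞} {c : ℝ≥0∞} (hc : c ≠ ∞)
    (hψ₁ : Measurable ψ₁)
    (h : ∀ a y, ψ a ≤ c * (ψ₁ (a + y) + ψ₂ y)) (z : H) :
    ∫⁻ t in Ioi (0 : ℝ), expWeight β t * ψ (T t z) ≤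
      c * (mehlerResolvent T μ β ψ₁ z + mehlerResolvent T μ β ψ₂ 0) := by
  have h1 : ∀ t, ψ (T t z) ≤
      c * (mehlerSemigroup T μ t ψ₁ z + mehlerSemigroup T μ t ψ₂ 0) := by
    intro t
    simp only [mehlerSemigroup, map_zero, zero_add]
    rw [← lintegral_add_left (by fun_prop), ← lintegral_const_mul' _ _ hc]
    calc ψ (T t z) = ∫⁻ _, ψ (T t z) ∂(μ t : Measure H) := by simp
      _ ≤ _ := lintegral_mono fun y => h _ y
  have hm : Measurable fun t => expWeight β t * mehlerSemigroup T μ (max t 0) ψ₁ z :=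
    (measurable_expWeight β).mul (measurable_mehlerSemigroup_time hT hμ hψ₁ z)
  rw [mehlerResolvent_eq_max _ ψ₁, mehlerResolvent, ← lintegral_add_left hm,
    ← lintegral_const_mul' _ _ hc]
  refine setLIntegral_mono' measurableSet_Ioi fun t ht => ?_
  rw [max_eq_left (le_of_lt (mem_Ioi.1 ht)), ← mul_add, mul_left_comm]
  exact mul_le_mul_right (h1 t) _

/-- The potential of a subadditive function `φ(‖·‖)` controls every functional `ℓ ≤ ‖·‖` that does
not decay instantly along the orbits of `(T_t)`. -/
theorem coercive_potential_norm {β : ℝ} (hβ : 0 < β) {φ : ℝ → ℝ≥0∞} (hφm : Measurable φ)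
    (hφ : Monotone φ) (hadd : ∀ r s, 0 ≤ r → 0 ≤ s → φ (r + s) ≤ φ r + φ s)
    (htop : ∀ L : ℝ≥0∞, L ≠ ∞ → ∃ R : ℝ, ∀ r, φ r ≤ L → r ≤ R)
    (h0 : mehlerResolvent T μ β (fun z => φ ‖z‖) 0 ≠ ∞)
    {ℓ : H → ℝ} (hℓ : ∀ a, ℓ a ≤ ‖a‖) {c δ : ℝ} (hc : 0 < c) (hδ : 0 < δ)
    (hlow : ∀ t, 0 < t → t < δ → ∀ z, c * ℓ z ≤ ℓ (T t z)) {L : ℝ≥0∞} (hL : L ≠ ∞) :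
    ∃ R : ℝ, ∀ z, mehlerResolvent T μ β (fun z => φ ‖z‖) z ≤ L → ℓ z ≤ R := by
  set κ : ℝ≥0∞ := ∫⁻ t in Ioo 0 δ, expWeight β t with hκ
  have hκe := lintegral_Ioo_expWeight hβ hδ
  rw [← hκ] at hκe
  have hκ0 : κ ≠ 0 := fun h => by
    rw [h, mul_zero, eq_comm, ENNReal.ofReal_eq_zero] at hκe
    have : Real.exp (-β * δ) < 1 := Real.exp_lt_one_iff.2 (by nlinarith)
    linarith
  have hκtop : κ ≠ ∞ := fun h => by
    rw [h, ENNReal.mul_top (ENNReal.ofReal_pos.2 hβ).ne'] at hκe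
    exact ENNReal.ofReal_ne_top hκe.symm
  obtain ⟨R, hR⟩ := htop (κ⁻¹ * (L + mehlerResolvent T μ β (fun z => φ ‖z‖) 0))
    (ENNReal.mul_ne_top (ENNReal.inv_ne_top.2 hκ0) (ENNReal.add_ne_top.2 ⟨hL, h0⟩))
  refine ⟨R / c, fun z hz => ?_⟩
  rw [le_div_iff₀' hc]
  refine hR _ ?_
  have h1 := lintegral_orbit_le hT hμ β (ψ := fun a => φ (ℓ a)) (ψ₁ := fun z => φ ‖z‖)
    (ψ₂ := fun z => φ ‖z‖) (c := 1) ENNReal.one_ne_top (hφm.comp measurable_norm) (fun a y => by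
      rw [one_mul]
      refine (hφ ?_).trans (hadd _ _ (norm_nonneg _) (norm_nonneg _))
      calc ℓ a ≤ ‖a‖ := hℓ a
        _ = ‖(a + y) - y‖ := by rw [add_sub_cancel_right]
        _ ≤ _ := norm_sub_le _ _) z
  have h2 : κ * φ (c * ℓ z) ≤ ∫⁻ t in Ioi (0 : ℝ), expWeight β t * φ (ℓ (T t z)) := by
    rw [hκ, ← lintegral_mul_const _ (measurable_expWeight β)]
    refine (setLIntegral_mono' measurableSet_Ioo fun t ht => ?_).trans
      (lintegral_mono_set Ioo_subset_Ioi_self)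
    exact mul_le_mul_right (hφ (hlow t ht.1 ht.2 z)) _
  rw [← ENNReal.div_eq_inv_mul, ENNReal.le_div_iff_mul_le (Or.inl hκ0) (Or.inl hκtop), mul_comm]
  refine (h2.trans h1).trans ?_
  rw [one_mul]
  gcongr

/-- For any two points some subadditive function of the norm has a finite potential at both. -/
theorem exists_subadditive_potential {β : ℝ} (hβ : 0 < β) (x : H) :
    ∃ φ : ℝ → ℝ≥0∞, Measurable φ ∧ Monotone φ ∧
      (∀ r s, 0 ≤ r → 0 ≤ s → φ (r + s) ≤ φ r + φ s) ∧
      (∀ L : ℝ≥0∞, L ≠ ∞ → ∃ R : ℝ, ∀ r, φ r ≤ L → r ≤ R) ∧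
      mehlerResolvent T μ β (fun z => φ ‖z‖) x ≠ ∞ ∧
      mehlerResolvent T μ β (fun z => φ ‖z‖) 0 ≠ ∞ := by
  obtain ⟨m, hm⟩ := exists_measure_lintegral_resolvent hT hμ β
    (Measure.dirac x + Measure.dirac (0 : H))
  have hm' : ∀ f : H → ℝ≥0∞, Measurable f →
      ∫⁻ z, f z ∂m = mehlerResolvent T μ β f x + mehlerResolvent T μ β f 0 := fun f hf => by
    rw [hm f hf, lintegral_add_measure,
      lintegral_dirac' _ (measurable_mehlerResolvent hT hμ β hf),
      lintegral_dirac' _ (measurable_mehlerResolvent hT hμ β hf)]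
  have hfin : IsFiniteMeasure m := ⟨by
    have h1 := hm' (fun _ => 1) measurable_const
    rw [lintegral_one, mehlerResolvent_const hβ, mehlerResolvent_const hβ] at h1
    rw [h1]
    simp [hβ]⟩
  obtain ⟨φ, h1, h2, h3, h4, h5⟩ := exists_subadditive_moment m
  rw [hm' (fun z => φ ‖z‖) (h1.comp measurable_norm), ENNReal.add_ne_top] at h5
  exact ⟨φ, h1, h2, h3, h4, h5⟩

end Lyapunov

/-! ### Generators of strongly continuous semigroups -/

section Generator

variable {H : Type*} [NormedAddCommGroup H] [InnerProductSpace ℝ H] {T : ℝ → H →L[ℝ] H}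
  (hT : IsC0Semigroup T)
include hT

theorem IsC0Semigroup.apply_add {s t : ℝ} (hs : 0 ≤ s) (ht : 0 ≤ t) (x : H) :
    T (s + t) x = T s (T t x) := by
  rw [hT.add s t hs ht, ContinuousLinearMap.comp_apply]

theorem IsC0Semigroup.tendsto_orbit {t : ℝ} (ht : 0 ≤ t) (x : (generator T).domain) :
    Tendsto (fun h : ℝ => h⁻¹ • (T h (T t x) - T t x)) (𝓝[>] 0) (𝓝 (T t (generator T x))) := by
  have h1 := ((T t).continuous.tendsto (generator T x)).comp (tendsto_generator T x)
  refine h1.congr' ?_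
  filter_upwards [self_mem_nhdsWithin] with h hh
  have hh : 0 < h := hh
  simp only [Function.comp_apply, map_smul, map_sub]
  rw [← hT.apply_add ht hh.le, ← hT.apply_add hh.le ht, add_comm]

/-- The generator commutes with the semigroup on its domain. -/
theorem IsC0Semigroup.generator_orbit {t : ℝ} (ht : 0 ≤ t) (x : (generator T).domain) :
    ∃ h : T t x ∈ (generator T).domain, generator T ⟨T t x, h⟩ = T t (generator T x) :=
  ⟨⟨_, hT.tendsto_orbit ht x⟩, tendsto_nhds_unique (tendsto_generator T _) (hT.tendsto_orbit ht x)⟩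

theorem IsC0Semigroup.hasDerivWithinAt {t : ℝ} (ht : 0 ≤ t) (x : (generator T).domain) :
    HasDerivWithinAt (fun s => T s (x : H)) (T t (generator T x)) (Ici t) t := by
  rw [← hasDerivWithinAt_Ioi_iff_Ici, hasDerivWithinAt_iff_tendsto_slope' self_notMem_Ioi]
  have h5 : Tendsto (fun s => s - t) (𝓝[>] t) (𝓝[>] 0) := by
    refine tendsto_nhdsWithin_iff.2 ⟨?_, ?_⟩
    · have : Tendsto (fun s : ℝ => s - t) (𝓝 t) (𝓝 (t - t)) :=
        (continuous_id.sub continuous_const).tendsto t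
      rw [sub_self] at this
      exact this.mono_left nhdsWithin_le_nhds
    · filter_upwards [self_mem_nhdsWithin] with s hs
      exact sub_pos.2 (mem_Ioi.1 hs)
  refine ((hT.tendsto_orbit ht x).comp h5).congr' ?_
  filter_upwards [self_mem_nhdsWithin] with s hs
  have hs : t < s := hs
  rw [slope_def_module, Function.comp_apply, ← hT.apply_add (sub_pos.2 hs).le ht, sub_add_cancel]

variable [CompleteSpace H]

/-- The generator is densely defined: the averages `t⁻¹ ∫₀ᵗ T_s x ds` lie in its domain. -/
theorem IsC0Semigroup.dense_domain : Dense ((generator T).domain : Set H) := by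
  intro x
  set g : ℝ → H := fun s => T (max s 0) x with hg
  have hgc : Continuous g := hT.continuous_max x
  have hderiv : ∀ u, HasDerivAt (fun u => ∫ s in (0 : ℝ)..u, g s) (g u) u := fun u =>
    intervalIntegral.integral_hasDerivAt_right (hgc.intervalIntegrable _ _)
      hgc.stronglyMeasurable.stronglyMeasurableAtFilter hgc.continuousAt
  have hg0 : g 0 = x := by simp [hg, hT.zero]
  have hmem : ∀ t : ℝ, 0 < t → t⁻¹ • ∫ s in (0 : ℝ)..t, g s ∈ (generator T).domain := by
    intro t ht
    refine Submodule.smul_mem _ _ ⟨g t - g 0, ?_⟩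
    refine ((hderiv t).tendsto_slope_zero_right.sub
      (hderiv 0).tendsto_slope_zero_right).congr' ?_
    filter_upwards [self_mem_nhdsWithin] with h hh
    have hh : 0 < h := hh
    rw [← smul_sub]
    congr 1
    have h1 : T h (∫ s in (0 : ℝ)..t, g s) = ∫ s in h..(t + h), g s := by
      rw [← ContinuousLinearMap.intervalIntegral_comp_comm _ (hgc.intervalIntegrable _ _)]
      have h2 := intervalIntegral.integral_comp_add_right (a := 0) (b := t) g h
      rw [zero_add] at h2
      rw [← h2]
      refine intervalIntegral.integral_congr fun s hs => ?_
      rw [uIcc_of_le ht.le] at hs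
      simp only [hg]
      rw [max_eq_left hs.1, max_eq_left (add_nonneg hs.1 hh.le), add_comm,
        hT.apply_add hh.le hs.1]
    have h3 := intervalIntegral.integral_add_adjacent_intervals
      (hgc.intervalIntegrable (μ := volume) 0 h) (hgc.intervalIntegrable h (t + h))
    rw [h1, ← h3]
    simp only [zero_add, intervalIntegral.integral_same, sub_zero]
    abel
  refine mem_closure_of_tendsto (f := fun t : ℝ => t⁻¹ • ∫ s in (0 : ℝ)..t, g s)
    (b := 𝓝[>] (0 : ℝ)) ?_ ?_
  · have h1 := (hderiv 0).tendsto_slope_zero_right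
    simpa [hg0] using h1
  · filter_upwards [self_mem_nhdsWithin] with t ht
    exact hmem t ht

theorem IsC0Semigroup.exists_norm_le : ∃ M : ℝ, 0 ≤ M ∧ ∀ t ∈ Icc (0 : ℝ) 1, ‖T t‖ ≤ M := by
  obtain ⟨M, hM⟩ := banach_steinhaus (g := fun t : Icc (0 : ℝ) 1 => T t) fun x => by
    obtain ⟨C, hC⟩ := isCompact_Icc.exists_bound_of_continuousOn
      ((hT.continuousOn x).mono (Icc_subset_Ici_self : Icc (0 : ℝ) 1 ⊆ _))
    exact ⟨C, fun t => hC t t.2⟩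
  exact ⟨M, (norm_nonneg _).trans (hM ⟨0, by simp⟩), fun t ht => hM ⟨t, ht⟩⟩

/-- If the generator is bounded, the semigroup is norm continuous at `0`, hence bounded below
for small times. -/
theorem IsC0Semigroup.lower_bound (hA : GeneratorBounded T) :
    ∃ δ : ℝ, 0 < δ ∧ ∀ t, 0 < t → t < δ → ∀ z, 2⁻¹ * ‖z‖ ≤ ‖T t z‖ := by
  obtain ⟨C, hC⟩ := hA
  obtain ⟨M, hM0, hM⟩ := hT.exists_norm_le
  have hdom : ∀ t ∈ Icc (0 : ℝ) 1, ∀ x ∈ (generator T).domain,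
      ‖T t x - x‖ ≤ M * (|C| * ‖x‖) * t := by
    intro t ht x hx
    have h1 := norm_image_sub_le_of_norm_deriv_right_le_segment
      (f := fun s => T s x) (f' := fun s => T s (generator T ⟨x, hx⟩)) (a := 0) (b := 1)
      (C := M * (|C| * ‖x‖)) ((hT.continuousOn x).mono Icc_subset_Ici_self)
      (fun s hs => hT.hasDerivWithinAt hs.1 ⟨x, hx⟩)
      (fun s hs => ((T s).le_opNorm _).trans (mul_le_mul (hM s ⟨hs.1, hs.2.le⟩)
        ((hC ⟨x, hx⟩).trans (mul_le_mul_of_nonneg_right (le_abs_self C) (norm_nonneg _)))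
        (norm_nonneg _) hM0)) t ht
    simpa [hT.zero] using h1
  have hall : ∀ t ∈ Icc (0 : ℝ) 1, ∀ x, ‖T t x - x‖ ≤ M * (|C| * ‖x‖) * t := by
    intro t ht x
    have hcl : IsClosed {x : H | ‖T t x - x‖ ≤ M * (|C| * ‖x‖) * t} :=
      isClosed_le (by fun_prop) (by fun_prop)
    exact hcl.closure_subset_iff.2 (fun x hx => hdom t ht x hx) (hT.dense_domain x)
  refine ⟨min 1 (2 * (M * |C| + 1))⁻¹, by positivity, fun t ht htδ z => ?_⟩
  have h1 := hall t ⟨ht.le, (htδ.trans_le (min_le_left _ _)).le⟩ z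
  have h2 : t * (2 * (M * |C| + 1)) ≤ 1 := by
    have h3 := (htδ.trans_le (min_le_right _ _)).le
    have h4 : 0 < 2 * (M * |C| + 1) := by positivity
    calc t * (2 * (M * |C| + 1)) ≤ (2 * (M * |C| + 1))⁻¹ * (2 * (M * |C| + 1)) := by gcongr
      _ = 1 := inv_mul_cancel₀ h4.ne'
  have h3 : M * (|C| * ‖z‖) * t ≤ 2⁻¹ * ‖z‖ := by
    have h5 : M * |C| * t ≤ 2⁻¹ := by linarith
    calc M * (|C| * ‖z‖) * t = (M * |C| * t) * ‖z‖ := by ring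
      _ ≤ _ := by gcongr
  have h4 : ‖z‖ ≤ ‖T t z‖ + ‖T t z - z‖ := by
    calc ‖z‖ = ‖T t z - (T t z - z)‖ := by rw [sub_sub_cancel]
      _ ≤ _ := norm_sub_le _ _
  linarith

/-- An eigenvector `e` of `A*` diagonalizes the semigroup: `⟨T_t x, e⟩ = e^{λt} ⟨x, e⟩`. -/
theorem IsC0Semigroup.inner_eigenvector {e : H} {l : ℝ}
    (he : ∃ h : e ∈ (generator T).adjoint.domain, (generator T).adjoint ⟨e, h⟩ = l • e)
    {t : ℝ} (ht : 0 ≤ t) (x : H) :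
    inner ℝ (T t x) e = Real.exp (l * t) * inner ℝ x e := by
  obtain ⟨hmem, heq⟩ := he
  have hadj : ∀ y : (generator T).domain, inner ℝ (generator T y) e = l * inner ℝ (y : H) e := by
    intro y
    have h1 := (generator T).adjoint_isFormalAdjoint hT.dense_domain ⟨e, hmem⟩ y
    rw [heq, inner_smul_left] at h1
    rw [real_inner_comm, ← h1, real_inner_comm e]
    rfl
  have hdom : ∀ x ∈ (generator T).domain,
      inner ℝ (T t x) e = Real.exp (l * t) * inner ℝ x e := by
    intro x hx
    have h1 := constant_of_has_deriv_right_zero (a := 0) (b := t)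
      (f := fun s => Real.exp (-l * s) * inner ℝ (T s x) e) ?_ ?_ t ⟨ht, le_rfl⟩
    · simp only [mul_zero, Real.exp_zero, hT.zero, one_mul, ContinuousLinearMap.id_apply] at h1
      rw [← h1, ← mul_assoc, ← Real.exp_add]
      simp
    · exact ContinuousOn.mul (by fun_prop) (((hT.continuousOn x).mono
        Icc_subset_Ici_self).inner continuousOn_const)
    · intro s hs
      obtain ⟨h2, h3⟩ := hT.generator_orbit hs.1 ⟨x, hx⟩
      have h4 := (hT.hasDerivWithinAt hs.1 ⟨x, hx⟩).inner ℝ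
        (hasDerivWithinAt_const s (Ici s) e)
      have h5 : HasDerivWithinAt (fun s => Real.exp (-l * s))
          (Real.exp (-l * s) * -l) (Ici s) s := by
        simpa using ((hasDerivAt_id s).const_mul (-l)).exp.hasDerivWithinAt
      have h6 := h5.mul h4
      rw [← h3, hadj ⟨_, h2⟩, inner_zero_right] at h6
      refine h6.congr_deriv ?_
      ring
  have hcl : IsClosed {x : H | inner ℝ (T t x) e = Real.exp (l * t) * inner ℝ x e} :=
    isClosed_eq (by fun_prop) (by fun_prop)
  exact hcl.closure_subset_iff.2 hdom (hT.dense_domain x)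

end Generator

/-! ### Truncated powers -/

section TruncPow

/-- The truncated power `|r|^p ∧ 1`. -/
noncomputable def truncPow (p r : ℝ) : ℝ≥0∞ := ENNReal.ofReal (min (|r| ^ p) 1)

theorem measurable_truncPow (p : ℝ) : Measurable (truncPow p) := by
  unfold truncPow; fun_prop

theorem truncPow_mono {p r s : ℝ} (hp : 0 ≤ p) (hr : 0 ≤ r) (h : r ≤ s) :
    truncPow p r ≤ truncPow p s := by
  refine ENNReal.ofReal_le_ofReal (min_le_min_right _ ?_)
  rw [abs_of_nonneg hr, abs_of_nonneg (hr.trans h)]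
  exact Real.rpow_le_rpow hr h hp

theorem truncPow_add_le {p r s : ℝ} (hp : 0 ≤ p) (hr : 0 ≤ r) (hs : 0 ≤ s) :
    truncPow p (r + s) ≤ ENNReal.ofReal (2 ^ p) * (truncPow p r + truncPow p s) := by
  have hmax : ∀ m : ℝ, 0 ≤ m → truncPow p (2 * m) ≤ ENNReal.ofReal (2 ^ p) * truncPow p m := by
    intro m hm
    have h2 : (1 : ℝ) ≤ 2 ^ p := Real.one_le_rpow one_le_two hp
    rw [truncPow, truncPow, ← ENNReal.ofReal_mul (by positivity), abs_of_nonneg hm,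
      abs_of_nonneg (by positivity), Real.mul_rpow zero_le_two hm]
    refine ENNReal.ofReal_le_ofReal ?_
    rw [mul_min_of_nonneg _ _ (by positivity), mul_one]
    exact min_le_min_left _ h2
  rcases le_total r s with h | h
  · exact (truncPow_mono hp (by positivity) (by linarith)).trans ((hmax s hs).trans
      (mul_le_mul_right le_add_self _))
  · exact (truncPow_mono hp (by positivity) (by linarith)).trans ((hmax r hr).trans
      (mul_le_mul_right le_self_add _))

/-- A pointwise form of Hölder's inequality: where the truncation is inactive, `w²` is dominated
by `l^a w^p` up to the summable error `l^{-2a/(p-2)}`. -/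
theorem sq_le_of_truncPow_lt_one {p a l w : ℝ} (hp : 2 ≤ p) (ha : 0 < a) (hl : 1 ≤ l) (hw : 0 ≤ w)
    (h : truncPow p w < 1) :
    ENNReal.ofReal (w ^ 2) ≤ ENNReal.ofReal (l ^ a) * truncPow p w +
      if 2 < p then ENNReal.ofReal (1 / l ^ (2 * a / (p - 2))) else 0 := by
  have hl0 : 0 < l := by linarith
  have hlt : w ^ p < 1 := by
    by_contra hge
    rw [truncPow, abs_of_nonneg hw, min_eq_right (not_lt.1 hge), ENNReal.ofReal_one] at h
    exact lt_irrefl _ h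
  have hpow : truncPow p w = ENNReal.ofReal (w ^ p) := by
    rw [truncPow, abs_of_nonneg hw, min_eq_left hlt.le]
  rw [hpow, ← ENNReal.ofReal_mul (by positivity)]
  rcases hp.eq_or_lt with rfl | hp2
  · rw [if_neg (lt_irrefl _), add_zero, Real.rpow_two]
    refine ENNReal.ofReal_le_ofReal ?_
    have h1 : 1 ≤ l ^ a := Real.one_le_rpow hl ha.le
    nlinarith [sq_nonneg w]
  · rw [if_pos hp2]
    have hq : 0 < p - 2 := by linarith
    rcases le_total 1 (l ^ a * w ^ (p - 2)) with hc | hc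
    · refine le_trans (ENNReal.ofReal_le_ofReal ?_) le_self_add
      have hwpos : 0 < w := by
        rcases hw.eq_or_lt with rfl | hw0
        · rw [Real.zero_rpow hq.ne', mul_zero] at hc
          linarith
        · exact hw0
      have h1 : w ^ p = w ^ (p - 2) * w ^ 2 := by
        rw [← Real.rpow_natCast w 2, ← Real.rpow_add hwpos]
        norm_num
      rw [h1, ← mul_assoc]
      nlinarith [sq_nonneg w]
    · refine le_trans (ENNReal.ofReal_le_ofReal ?_) le_add_self
      have h1 : (l ^ a * w ^ (p - 2)) ^ (2 / (p - 2)) ≤ 1 :=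
        Real.rpow_le_one (by positivity) hc (by positivity)
      rw [Real.mul_rpow (by positivity) (by positivity), ← Real.rpow_mul hl0.le,
        ← Real.rpow_mul hw, mul_div_cancel₀ _ hq.ne', Real.rpow_two, mul_div_assoc',
        mul_comm a 2] at h1
      rw [le_div_iff₀ (by positivity)]
      linarith

end TruncPow

/-! ### The truncated energy -/

section Energy

variable {H : Type*} [NormedAddCommGroup H] [InnerProductSpace ℝ H]

/-- The weighted sum `∑ W_i ((|⟨z, e_i⟩| - c_i)⁺ ^ p ∧ 1)`, measuring by how much the coordinates of
`z` exceed the thresholds `c_i`. -/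
noncomputable def truncEnergy (e : ℕ → H) (p : ℝ) (W : ℕ → ℝ≥0∞) (c : ℕ → ℝ) (z : H) : ℝ≥0∞ :=
  ∑' i, W i * truncPow p (max (|inner ℝ z (e i)| - c i) 0)

theorem truncEnergy_le_add {e : ℕ → H} {p : ℝ} (hp : 0 ≤ p) (W : ℕ → ℝ≥0∞) (c : ℕ → ℝ) (z y : H) :
    truncEnergy e p W c z ≤
      ENNReal.ofReal (2 ^ p) * (truncEnergy e p W c (z + y) + truncEnergy e p W 0 y) := by
  simp only [truncEnergy]
  rw [← ENNReal.tsum_add, ← ENNReal.tsum_mul_left]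
  refine ENNReal.tsum_le_tsum fun i => ?_
  rw [← mul_add, mul_left_comm]
  refine mul_le_mul_right ?_ _
  refine le_trans (truncPow_mono hp (le_max_right _ _) ?_)
    (truncPow_add_le hp (le_max_right _ _) (le_max_right _ _))
  have h1 : |inner ℝ z (e i)| ≤ |inner ℝ (z + y) (e i)| + |inner ℝ y (e i)| := by
    rw [inner_add_left]
    calc |inner ℝ z (e i)| = |(inner ℝ z (e i) + inner ℝ y (e i)) - inner ℝ y (e i)| := by
          rw [add_sub_cancel_right]
      _ ≤ _ := abs_sub _ _
  simp only [Pi.zero_apply, sub_zero, max_eq_left (abs_nonneg (inner ℝ y (e i)))]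
  refine max_le ?_ (by positivity)
  have := le_max_left (|inner ℝ (z + y) (e i)| - c i) 0
  linarith

theorem truncEnergy_add_le {e : ℕ → H} {p : ℝ} (hp : 0 ≤ p) {W : ℕ → ℝ≥0∞} {c : ℕ → ℝ} {x : H}
    (h : ∀ i, W i ≠ 0 → |inner ℝ x (e i)| ≤ c i) (y : H) :
    truncEnergy e p W c (x + y) ≤ truncEnergy e p W 0 y := by
  refine ENNReal.tsum_le_tsum fun i => ?_
  by_cases hW : W i = 0
  · simp [hW]
  refine mul_le_mul_right (truncPow_mono hp (le_max_right _ _) (max_le_max_right _ ?_)) _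
  rw [inner_add_left]
  have := abs_add_le (inner ℝ x (e i)) (inner ℝ y (e i))
  have := h i hW
  simp only [Pi.zero_apply, sub_zero]
  linarith

/-- A vector `z` with bounded coordinates for which the energy of `κ z` above the thresholds
`|⟨x, e_i⟩|` is at most `L` is bounded: where the weight `|λ_i|^a` exceeds `L` the truncation is
inactive and Hölder's inequality applies, and only finitely many other coordinates remain. -/
theorem exists_norm_le_of_energy [CompleteSpace H] (e : HilbertBasis ℕ ℝ H) {lam : ℕ → ℝ}
    (hlam : Tendsto lam atTop atBot) {p a : ℝ} (hp : 2 ≤ p) (ha : 0 < a)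
    (hsum : 2 < p → Summable fun i => 1 / |lam i| ^ (2 * a / (p - 2)))
    (x : H) {L : ℝ≥0∞} (hL : L ≠ ∞) {N₀ : ℕ} {κ : ℝ} (hκ : 0 < κ) {R : ℕ → ℝ} :
    ∃ M : ℝ, ∀ z : H, (∀ i, |inner ℝ z (e i)| ≤ R i) →
      truncEnergy e p (fun i => if N₀ ≤ i then ENNReal.ofReal (|lam i| ^ a) else 0)
        (fun i => |inner ℝ x (e i)|) (κ • z) ≤ L → ‖z‖ ≤ M := by
  have hev : ∀ᶠ i in atTop, N₀ ≤ i ∧ 1 ≤ |lam i| ∧ L < ENNReal.ofReal (|lam i| ^ a) := by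
    have h1 : Tendsto (fun i => |lam i|) atTop atTop := tendsto_abs_atBot_atTop.comp hlam
    have h2 : Tendsto (fun i => ENNReal.ofReal (|lam i| ^ a)) atTop (𝓝 ∞) :=
      ENNReal.tendsto_ofReal_atTop.comp ((tendsto_rpow_atTop ha).comp h1)
    exact (eventually_ge_atTop N₀).and ((h1.eventually_ge_atTop 1).and
      (h2.eventually (lt_mem_nhds hL.lt_top)))
  obtain ⟨N, hN⟩ := eventually_atTop.1 hev
  set W : ℕ → ℝ≥0∞ := fun i => if N₀ ≤ i then ENNReal.ofReal (|lam i| ^ a) else 0 with hW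
  set err : ℕ → ℝ≥0∞ := fun i =>
    if 2 < p then ENNReal.ofReal (1 / |lam i| ^ (2 * a / (p - 2))) else 0 with herr
  have herrsum : ∑' i, err i ≠ ∞ := by
    by_cases h2 : 2 < p
    · simp only [herr, if_pos h2]
      exact (hsum h2).tsum_ofReal_ne_top
    · simp [herr, if_neg h2]
  have hparseval : ∀ y : H, ∑' i, ENNReal.ofReal (inner ℝ y (e i) ^ 2) =
      ENNReal.ofReal (‖y‖ ^ 2) := by
    intro y
    have h1 := e.hasSum_inner_mul_inner y y
    simp only [real_inner_comm y, ← pow_two, real_inner_self_eq_norm_sq] at h1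
    rw [← h1.tsum_eq, ENNReal.ofReal_tsum_of_nonneg (fun i => sq_nonneg _) h1.summable]
  set B : ℝ≥0∞ := ∑ i ∈ Finset.range N, ENNReal.ofReal (R i ^ 2) +
    ENNReal.ofReal (2 / κ ^ 2) * (L + ∑' i, err i + ENNReal.ofReal (‖x‖ ^ 2)) with hB
  have hBtop : B ≠ ∞ := by
    refine ENNReal.add_ne_top.2 ⟨?_, ENNReal.mul_ne_top ENNReal.ofReal_ne_top
      (ENNReal.add_ne_top.2 ⟨ENNReal.add_ne_top.2 ⟨hL, herrsum⟩, ENNReal.ofReal_ne_top⟩)⟩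
    exact (ENNReal.sum_lt_top.2 fun i _ => ENNReal.ofReal_lt_top).ne
  refine ⟨√B.toReal, fun z hz hE => Real.le_sqrt_of_sq_le ?_⟩
  rw [← ENNReal.ofReal_le_iff_le_toReal hBtop, ← hparseval]
  set w : ℕ → ℝ := fun i => max (|inner ℝ (κ • z) (e i)| - |inner ℝ x (e i)|) 0 with hw
  have hterm : ∀ i, ENNReal.ofReal (inner ℝ z (e i) ^ 2) ≤
      (if i ∈ Finset.range N then ENNReal.ofReal (R i ^ 2) else 0) +
        ENNReal.ofReal (2 / κ ^ 2) *
          (W i * truncPow p (w i) + err i + ENNReal.ofReal (inner ℝ x (e i) ^ 2)) := by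
    intro i
    by_cases hi : i < N
    · rw [if_pos (Finset.mem_range.2 hi)]
      refine le_trans (ENNReal.ofReal_le_ofReal ?_) le_self_add
      exact sq_le_sq' (by linarith [(abs_le.1 (hz i)).1]) (abs_le.1 (hz i)).2
    · obtain ⟨h1, h2, h3⟩ := hN i (not_lt.1 hi)
      have hWi : W i = ENNReal.ofReal (|lam i| ^ a) := if_pos h1
      have h4 : W i * truncPow p (w i) ≤ L :=
        (ENNReal.le_tsum (f := fun i => W i * truncPow p (w i)) i).trans hE
      have h5 : truncPow p (w i) < 1 := by
        by_contra hge
        refine absurd (h4.trans_lt h3) (not_lt.2 ?_)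
        rw [← hWi]
        exact le_mul_of_one_le_right' (not_lt.1 hge)
      have h6 := sq_le_of_truncPow_lt_one hp ha h2 (le_max_right _ _) h5
      rw [← hWi] at h6
      refine le_trans ?_ le_add_self
      refine le_trans ?_ (mul_le_mul_right (add_le_add_left h6 _) _)
      rw [← ENNReal.ofReal_add (sq_nonneg _) (sq_nonneg _), ← ENNReal.ofReal_mul (by positivity)]
      refine ENNReal.ofReal_le_ofReal ?_
      have h7 : κ * |inner ℝ z (e i)| ≤ w i + |inner ℝ x (e i)| := by
        have := le_max_left (|inner ℝ (κ • z) (e i)| - |inner ℝ x (e i)|) 0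
        rw [inner_smul_left, abs_mul] at this
        simp only [conj_trivial, abs_of_pos hκ] at this
        have h8 : w i = max (κ * |inner ℝ z (e i)| - |inner ℝ x (e i)|) 0 := by
          simp only [hw]
          rw [inner_smul_left, abs_mul]
          simp only [conj_trivial, abs_of_pos hκ]
        rw [h8]
        linarith
      have h9 : κ ^ 2 * inner ℝ z (e i) ^ 2 ≤ 2 * (w i ^ 2 + inner ℝ x (e i) ^ 2) := by
        rw [← sq_abs (inner ℝ z (e i)), ← sq_abs (inner ℝ x (e i)), ← mul_pow]
        calc (κ * |inner ℝ z (e i)|) ^ 2 ≤ (w i + |inner ℝ x (e i)|) ^ 2 := by gcongr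
          _ ≤ _ := add_sq_le
      rw [div_mul_eq_mul_div, le_div_iff₀ (by positivity)]
      linarith
  calc ∑' i, ENNReal.ofReal (inner ℝ z (e i) ^ 2) ≤ _ := ENNReal.tsum_le_tsum hterm
    _ = ∑ i ∈ Finset.range N, ENNReal.ofReal (R i ^ 2) + ENNReal.ofReal (2 / κ ^ 2) *
        (∑' i, W i * truncPow p (w i) + ∑' i, err i + ENNReal.ofReal (‖x‖ ^ 2)) := by
      rw [ENNReal.tsum_add, ENNReal.tsum_mul_left, ENNReal.tsum_add, ENNReal.tsum_add, hparseval,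
        tsum_eq_sum (s := Finset.range N) (fun i hi => if_neg hi)]
      congr 1
      exact Finset.sum_congr rfl fun i hi => if_pos hi
    _ ≤ B := by
      rw [hB]
      gcongr
      exact hE

end Energy

/-! ### The nest property in the two cases -/

section Nest

variable {H : Type*} [NormedAddCommGroup H] [InnerProductSpace ℝ H]
  {T : ℝ → H →L[ℝ] H} [MeasurableSpace H] {μ : ℝ → ProbabilityMeasure H}
  [BorelSpace H] [SecondCountableTopology H]
  (hT : IsC0Semigroup T) (hμ : IsMehlerFamily T μ)

theorem measurable_truncEnergy_term (e : H) (p : ℝ) (W : ℝ≥0∞) (c : ℝ) :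
    Measurable fun z : H => W * truncPow p (max (|inner ℝ z e| - c) 0) :=
  ((measurable_truncPow p).comp (by fun_prop : Measurable fun z : H =>
    max (|inner ℝ z e| - c) 0)).const_mul _

theorem measurable_truncEnergy (e : ℕ → H) (p : ℝ) (W : ℕ → ℝ≥0∞) (c : ℕ → ℝ) :
    Measurable (truncEnergy e p W c) :=
  Measurable.tsum fun i => measurable_truncEnergy_term (e i) p (W i) (c i)

include hT hμ

theorem mehlerResolvent_tsum (α : ℝ) {f : ℕ → H → ℝ≥0∞} (hf : ∀ i, Measurable (f i)) (x : H) :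
    mehlerResolvent T μ α (fun z => ∑' i, f i z) x = ∑' i, mehlerResolvent T μ α (f i) x := by
  simp_rw [mehlerResolvent_eq_max]
  have hm : ∀ i, Measurable fun t => expWeight α t * mehlerSemigroup T μ (max t 0) (f i) x :=
    fun i => (measurable_expWeight α).mul (measurable_mehlerSemigroup_time hT hμ (hf i) x)
  rw [← lintegral_tsum fun i => (hm i).aemeasurable]
  refine lintegral_congr fun t => ?_
  simp only [mehlerSemigroup]
  rw [lintegral_tsum fun i => by have := hf i; fun_prop, ENNReal.tsum_mul_left]

theorem isNest_of_bounded [CompleteSpace H] (hA : GeneratorBounded T) :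
    IsNest (mehlerResolvent T μ) fun n : ℕ => Metric.closedBall (0 : H) ((n : ℝ) + 1) := by
  refine isNest_closedBall one_pos fun x => ?_
  obtain ⟨φ, h1, h2, h3, h4, h5, h6⟩ := exists_subadditive_potential hT hμ one_pos x
  obtain ⟨δ, hδ, hlow⟩ := hT.lower_bound hA
  exact ⟨_, isExcessive_mehlerResolvent hT hμ 1 (h1.comp measurable_norm), h5, fun L hL =>
    coercive_potential_norm hT hμ one_pos h1 h2 h3 h4 h6 (ℓ := fun a => ‖a‖) (fun a => le_rfl)
      (by norm_num) hδ hlow hL⟩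

theorem isNest_of_conditionHAmu [CompleteSpace H] (hA : ConditionHAmu T μ) :
    IsNest (mehlerResolvent T μ) fun n : ℕ => Metric.closedBall (0 : H) ((n : ℝ) + 1) := by
  obtain ⟨e, lam, p, a, q, -, heig, -, -, hlim, hp, ha, -, hii, -, hsum, -⟩ := hA
  have hp0 : 0 ≤ p := by linarith
  set β : ℝ := max q 1 with hβdef
  have hβ : 0 < β := lt_max_of_lt_right one_pos
  refine isNest_closedBall hβ fun x => ?_
  obtain ⟨φ, hφm, hφ, hadd, htop, hφx, hφ0⟩ := exists_subadditive_potential hT hμ hβ x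
  obtain ⟨N₀, hN₀⟩ := eventually_atTop.1 (hlim.eventually_le_atBot (-1))
  set W : ℕ → ℝ≥0∞ := fun i => if N₀ ≤ i then ENNReal.ofReal (|lam i| ^ (1 + a)) else 0 with hW
  have hWtop : ∀ i, W i ≠ ∞ := fun i => by
    by_cases hi : N₀ ≤ i <;> simp [hW, hi]
  set c : ℕ → ℝ := fun i => |inner ℝ x (e i)| with hc
  have hinner : ∀ t, 0 ≤ t → ∀ z i,
      inner ℝ (T t z) (e i) = Real.exp (lam i * t) * inner ℝ z (e i) :=
    fun t ht z i => hT.inner_eigenvector (heig i) ht z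
  -- The energy potential at the origin is the series of condition (ii).
  have hE0 : mehlerResolvent T μ β (truncEnergy e p W 0) 0 ≠ ∞ := by
    refine ne_top_of_le_ne_top hii.ne ?_
    unfold truncEnergy
    rw [mehlerResolvent_tsum hT hμ _ fun i => measurable_truncEnergy_term (e i) p (W i) _]
    refine ENNReal.tsum_le_tsum fun i => ?_
    rw [mehlerResolvent_const_mul _ (hWtop i)]
    refine mul_le_mul' ?_ (setLIntegral_mono' measurableSet_Ioi fun t ht => ?_)
    · by_cases hi : N₀ ≤ i <;> simp [hW, hi]
    · have ht : 0 < t := ht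
      refine mul_le_mul' (ENNReal.ofReal_le_ofReal ?_) (le_of_eq ?_)
      · have : q ≤ β := le_max_left _ _
        gcongr
      · simp [mehlerSemigroup, truncPow]
  -- Thresholds at `|⟨x, e_i⟩|` are not exceeded by the orbit of `x`, as `λ_i < 0`.
  have hEx : mehlerResolvent T μ β (truncEnergy e p W c) x ≠ ∞ := by
    refine ne_top_of_le_ne_top hE0 (setLIntegral_mono' measurableSet_Ioi fun t ht => ?_)
    have ht : 0 < t := ht
    refine mul_le_mul_right (lintegral_mono fun y => ?_) _
    rw [map_zero, zero_add]
    refine truncEnergy_add_le hp0 (fun i hi => ?_) y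
    have hi' : N₀ ≤ i := by
      by_contra h
      exact hi (if_neg h)
    rw [hinner t ht.le, abs_mul, abs_of_pos (Real.exp_pos _)]
    refine mul_le_of_le_one_left (abs_nonneg _) (Real.exp_le_one_iff.2 ?_)
    nlinarith [hN₀ i hi']
  have hφm' : Measurable fun z : H => φ ‖z‖ := hφm.comp measurable_norm
  have hEm : Measurable (truncEnergy e p W c) := measurable_truncEnergy _ _ _ _
  refine ⟨_, isExcessive_mehlerResolvent hT hμ β (hφm'.add hEm), ?_, fun L hL => ?_⟩
  · have h1 := mehlerResolvent_add hT hμ β (g := truncEnergy e p W c) hφm' x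
    exact h1.trans_ne (ENNReal.add_ne_top.2 ⟨hφx, hEx⟩)
  have hcoord : ∀ i, ∃ R : ℝ, ∀ z, mehlerResolvent T μ β (fun z => φ ‖z‖) z ≤ L →
      |inner ℝ z (e i)| ≤ R := by
    intro i
    refine coercive_potential_norm hT hμ hβ hφm hφ hadd htop hφ0
      (ℓ := fun z => |inner ℝ z (e i)|) (fun z => ?_) (c := Real.exp (-|lam i|)) (δ := 1)
      (Real.exp_pos _) one_pos (fun t ht ht1 z => ?_) hL
    · simpa [e.orthonormal.1 i] using abs_real_inner_le_norm z (e i)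
    · rw [hinner t ht.le, abs_mul, abs_of_pos (Real.exp_pos _)]
      gcongr
      nlinarith [neg_abs_le (lam i), abs_nonneg (lam i)]
  choose R hR using hcoord
  set L' : ℝ≥0∞ := (ENNReal.ofReal (Real.exp (-β)))⁻¹ *
    (ENNReal.ofReal (2 ^ p) * (L + mehlerResolvent T μ β (truncEnergy e p W 0) 0)) with hL'
  have hL'top : L' ≠ ∞ := ENNReal.mul_ne_top
    (ENNReal.inv_ne_top.2 (ENNReal.ofReal_pos.2 (Real.exp_pos _)).ne')
    (ENNReal.mul_ne_top ENNReal.ofReal_ne_top (ENNReal.add_ne_top.2 ⟨hL, hE0⟩))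
  obtain ⟨M, hM⟩ := exists_norm_le_of_energy e hlim hp ha hsum x hL'top (N₀ := N₀)
    (Real.exp_pos (-1)) (R := R)
  refine ⟨M, fun z hz => ?_⟩
  refine hM z (fun i => hR i z (le_trans (mehlerResolvent_mono (fun y => le_self_add) _ _) hz)) ?_
  have hz2 : mehlerResolvent T μ β (truncEnergy e p W c) z ≤ L :=
    le_trans (mehlerResolvent_mono (fun y => le_add_self) _ _) hz
  have horb := lintegral_orbit_le hT hμ β (ψ := truncEnergy e p W c) (ψ₁ := truncEnergy e p W c)
    (ψ₂ := truncEnergy e p W 0) (c := ENNReal.ofReal (2 ^ p)) ENNReal.ofReal_ne_top hEm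
    (fun a y => truncEnergy_le_add hp0 W c a y) z
  -- The orbit of `z` stays above `z / e` in the `i`-th coordinate for a time `1 / |λ_i|`, which
  -- turns the weight `|λ_i|^{1+a}` into `|λ_i|^a`.
  have hlow : ENNReal.ofReal (Real.exp (-β)) * truncEnergy e p
      (fun i => if N₀ ≤ i then ENNReal.ofReal (|lam i| ^ a) else 0) c (Real.exp (-1) • z) ≤
        ∫⁻ t in Ioi (0 : ℝ), expWeight β t * truncEnergy e p W c (T t z) := by
    simp only [truncEnergy]
    simp_rw [← ENNReal.tsum_mul_left]
    have hmeas : ∀ i, Measurable fun t : ℝ => expWeight β t *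
        (W i * truncPow p (max (|inner ℝ (T (max t 0) z) (e i)| - c i) 0)) := fun i =>
      (measurable_expWeight β).mul ((measurable_truncEnergy_term (e i) p (W i) (c i)).comp
        (hT.continuous_max z).measurable)
    have hmax : ∀ t ∈ Ioi (0 : ℝ), (∑' i, expWeight β t *
        (W i * truncPow p (max (|inner ℝ (T t z) (e i)| - c i) 0))) = ∑' i, expWeight β t *
        (W i * truncPow p (max (|inner ℝ (T (max t 0) z) (e i)| - c i) 0)) := fun t ht => by
      rw [max_eq_left (le_of_lt (mem_Ioi.1 ht))]
    rw [setLIntegral_congr_fun measurableSet_Ioi hmax,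
      lintegral_tsum fun i => (hmeas i).aemeasurable]
    refine ENNReal.tsum_le_tsum fun i => ?_
    by_cases hi : N₀ ≤ i
    swap
    · simp [hi]
    have hl : lam i ≤ -1 := hN₀ i hi
    have habs : |lam i| = -lam i := abs_of_neg (by linarith)
    have hl0 : 0 < |lam i| := by rw [habs]; linarith
    simp only [hW, if_pos hi]
    set w := truncPow p (max (|inner ℝ (Real.exp (-1) • z) (e i)| - c i) 0) with hwdef
    calc ENNReal.ofReal (Real.exp (-β)) * (ENNReal.ofReal (|lam i| ^ a) * w)
        = ∫⁻ t in Ioo 0 (|lam i|⁻¹), ENNReal.ofReal (Real.exp (-β)) *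
            (ENNReal.ofReal (|lam i| ^ (1 + a)) * w) := by
          rw [setLIntegral_const, Real.volume_Ioo, sub_zero, Real.rpow_add hl0, Real.rpow_one,
            ENNReal.ofReal_mul hl0.le, ENNReal.ofReal_inv_of_pos hl0]
          have h1 : ENNReal.ofReal |lam i| * (ENNReal.ofReal |lam i|)⁻¹ = 1 :=
            ENNReal.mul_inv_cancel (ENNReal.ofReal_pos.2 hl0).ne' ENNReal.ofReal_ne_top
          calc _ = ENNReal.ofReal (Real.exp (-β)) * (ENNReal.ofReal (|lam i| ^ a) * w) *
                (ENNReal.ofReal |lam i| * (ENNReal.ofReal |lam i|)⁻¹) := by rw [h1, mul_one]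
            _ = _ := by ring
      _ ≤ ∫⁻ t in Ioo 0 (|lam i|⁻¹), expWeight β t * (ENNReal.ofReal (|lam i| ^ (1 + a)) *
            truncPow p (max (|inner ℝ (T (max t 0) z) (e i)| - c i) 0)) := by
          refine setLIntegral_mono' measurableSet_Ioo fun t ht => ?_
          have h1 : |lam i| * t ≤ 1 := by
            calc |lam i| * t ≤ |lam i| * |lam i|⁻¹ := by gcongr; exact ht.2.le
              _ = 1 := mul_inv_cancel₀ hl0.ne'
          have h2 : t ≤ 1 := by
            have : 1 ≤ |lam i| := by rw [habs]; linarith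
            nlinarith [ht.1]
          refine mul_le_mul' (ENNReal.ofReal_le_ofReal ?_) (mul_le_mul_right ?_ _)
          · gcongr
            nlinarith
          · refine truncPow_mono hp0 (le_max_right _ _) (max_le_max_right _ ?_)
            rw [max_eq_left ht.1.le, hinner t ht.1.le, inner_smul_left, abs_mul, abs_mul,
              abs_of_pos (Real.exp_pos _)]
            simp only [conj_trivial, abs_of_pos (Real.exp_pos _)]
            gcongr
            rw [habs] at h1
            linarith
      _ ≤ _ := lintegral_mono_set Ioo_subset_Ioi_self
  rw [hL', ← ENNReal.div_eq_inv_mul, ENNReal.le_div_iff_mul_le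
    (Or.inl (ENNReal.ofReal_pos.2 (Real.exp_pos _)).ne') (Or.inl ENNReal.ofReal_ne_top), mul_comm]
  refine (hlow.trans horb).trans ?_
  gcongr

end Nest

/-! ### Trigonometric test functions -/

section Trig

variable {H : Type*} [NormedAddCommGroup H] [InnerProductSpace ℝ H]

/-- The trigonometric test function `1 + cos(⟨x, ξ⟩ - θ)`. The summand `1` makes it nonnegative, so
that its potential is a difference with vanishing second term. -/
noncomputable def trig (ξ : H) (θ : ℝ) (x : H) : ℝ := 1 + Real.cos (inner ℝ x ξ - θ)

theorem trig_nonneg (ξ : H) (θ : ℝ) (x : H) : 0 ≤ trig ξ θ x := by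
  have := Real.neg_one_le_cos (inner ℝ x ξ - θ)
  unfold trig
  linarith

theorem trig_le_two (ξ : H) (θ : ℝ) (x : H) : trig ξ θ x ≤ 2 := by
  have := Real.cos_le_one (inner ℝ x ξ - θ)
  unfold trig
  linarith

theorem continuous_trig (ξ : H) (θ : ℝ) : Continuous (trig ξ θ) := by
  unfold trig
  fun_prop

/-- `trig ξ θ` as an extended nonnegative function. -/
noncomputable def trigE (ξ : H) (θ : ℝ) (x : H) : ℝ≥0∞ := ENNReal.ofReal (trig ξ θ x)

theorem continuous_trigE (ξ : H) (θ : ℝ) : Continuous (trigE ξ θ) :=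
  ENNReal.continuous_ofReal.comp (continuous_trig ξ θ)

theorem trigE_le_two (ξ : H) (θ : ℝ) (x : H) : trigE ξ θ x ≤ 2 := by
  have h := ENNReal.ofReal_le_ofReal (trig_le_two ξ θ x)
  rwa [ENNReal.ofReal_ofNat] at h

variable [MeasurableSpace H] [BorelSpace H]

theorem measurable_trigE (ξ : H) (θ : ℝ) : Measurable (trigE ξ θ) :=
  (continuous_trigE ξ θ).measurable

theorem integrable_cos_inner [SecondCountableTopology H] (m : Measure H) [IsFiniteMeasure m]
    (ξ : H) (θ : ℝ) : Integrable (fun x => Real.cos (inner ℝ x ξ - θ)) m :=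
  Integrable.of_bound (by fun_prop) 1 (Eventually.of_forall fun x => Real.abs_cos_le_one _)

theorem integral_cos_eq_of_trigE [SecondCountableTopology H] {m₁ m₂ : Measure H}
    [IsProbabilityMeasure m₁] [IsProbabilityMeasure m₂] {ξ : H} {θ : ℝ}
    (h : ∫⁻ x, trigE ξ θ x ∂m₁ = ∫⁻ x, trigE ξ θ x ∂m₂) :
    ∫ x, Real.cos (inner ℝ x ξ - θ) ∂m₁ = ∫ x, Real.cos (inner ℝ x ξ - θ) ∂m₂ := by
  have key : ∀ m : Measure H, [IsProbabilityMeasure m] →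
      ∫⁻ x, trigE ξ θ x ∂m = ENNReal.ofReal (1 + ∫ x, Real.cos (inner ℝ x ξ - θ) ∂m) ∧
        0 ≤ 1 + ∫ x, Real.cos (inner ℝ x ξ - θ) ∂m := by
    intro m _
    have hc := integrable_cos_inner m ξ θ
    have ht : Integrable (trig ξ θ) m := (integrable_const 1).add hc
    have hsum : ∫ x, trig ξ θ x ∂m = 1 + ∫ x, Real.cos (inner ℝ x ξ - θ) ∂m := by
      unfold trig
      rw [integral_add (integrable_const 1) hc]
      simp
    constructor
    · rw [← hsum, ofReal_integral_eq_lintegral_ofReal ht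
        (Eventually.of_forall (trig_nonneg ξ θ))]
      rfl
    · rw [← hsum]
      exact integral_nonneg (trig_nonneg ξ θ)
  obtain ⟨h1, h2⟩ := key m₁
  obtain ⟨h3, h4⟩ := key m₂
  rw [h1, h3, ENNReal.ofReal_eq_ofReal_iff h2 h4] at h
  linarith

/-- Countably many trigonometric functions determine a probability measure: they determine the
characteristic function on a dense set. -/
theorem ext_of_trigE [SecondCountableTopology H] [CompleteSpace H] {m₁ m₂ : Measure H}
    [IsProbabilityMeasure m₁] [IsProbabilityMeasure m₂] {d : ℕ → H} (hd : DenseRange d)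
    (h0 : ∀ n, ∫⁻ x, trigE (d n) 0 x ∂m₁ = ∫⁻ x, trigE (d n) 0 x ∂m₂)
    (h1 : ∀ n, ∫⁻ x, trigE (d n) (Real.pi / 2) x ∂m₁ = ∫⁻ x, trigE (d n) (Real.pi / 2) x ∂m₂) :
    m₁ = m₂ := by
  have key : ∀ m : Measure H, [IsProbabilityMeasure m] → ∀ ξ : H, charFun m ξ =
      ((∫ x, Real.cos (inner ℝ x ξ - 0) ∂m : ℝ) : ℂ) +
        ((∫ x, Real.cos (inner ℝ x ξ - Real.pi / 2) ∂m : ℝ) : ℂ) * Complex.I := by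
    intro m _ ξ
    rw [charFun_apply, ← integral_complex_ofReal, ← integral_complex_ofReal,
      ← integral_mul_const, ← integral_add]
    · refine integral_congr_ae (Eventually.of_forall fun x => ?_)
      simp only [sub_zero, Real.cos_sub_pi_div_two, Complex.exp_mul_I, Complex.ofReal_cos,
        Complex.ofReal_sin]
    · exact (integrable_cos_inner m ξ 0).ofReal
    · exact (integrable_cos_inner m ξ _).ofReal.mul_const _
  refine Measure.ext_of_charFun (hd.equalizer continuous_charFun continuous_charFun ?_)
  funext n
  simp only [Function.comp_apply]
  rw [key m₁, key m₂, integral_cos_eq_of_trigE (h0 n), integral_cos_eq_of_trigE (h1 n)]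

end Trig

/-! ### Separation of measures by potentials -/

section Separation

variable {H : Type*} [NormedAddCommGroup H] [InnerProductSpace ℝ H]
  {T : ℝ → H →L[ℝ] H} [MeasurableSpace H] {μ : ℝ → ProbabilityMeasure H}

theorem mehlerResolvent_le_of_le {α : ℝ} (hα : 0 < α) {c : ℝ≥0∞} {f : H → ℝ≥0∞}
    (hf : ∀ x, f x ≤ c) (x : H) :
    mehlerResolvent T μ α f x ≤ (ENNReal.ofReal α)⁻¹ * c :=
  (mehlerResolvent_mono hf α x).trans_eq (mehlerResolvent_const hα c x)

theorem setLIntegral_Ioi_comp_mul {a : ℝ} (ha : 0 < a) {F : ℝ → ℝ≥0∞} (hF : Measurable F) :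
    ENNReal.ofReal a * ∫⁻ t in Ioi (0 : ℝ), F (a * t) = ∫⁻ s in Ioi (0 : ℝ), F s := by
  have h1 : ∫⁻ s, (Ioi (0 : ℝ)).indicator F s =
      ENNReal.ofReal a * ∫⁻ t, (Ioi (0 : ℝ)).indicator F (a * t) := by
    conv_lhs => rw [← Real.smul_map_volume_mul_left ha.ne', abs_of_pos ha]
    rw [lintegral_smul_measure, lintegral_map (hF.indicator measurableSet_Ioi) (by fun_prop),
      smul_eq_mul]
  rw [← lintegral_indicator measurableSet_Ioi F, h1, ← lintegral_indicator measurableSet_Ioi]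
  congr 1
  refine lintegral_congr fun t => ?_
  simp [indicator, mul_pos_iff_of_pos_left ha]

variable [BorelSpace H] [SecondCountableTopology H]
  (hT : IsC0Semigroup T) (hμ : IsMehlerFamily T μ)
include hT hμ

/-- The resolvent is an approximate identity: `α U_α f → f` as `α → ∞`. -/
theorem tendsto_mul_mehlerResolvent {f : H → ℝ≥0∞} (hf : Measurable f) {c : ℝ≥0∞} (hc : c ≠ ∞)
    (hfc : ∀ z, f z ≤ c) {x : H}
    (hlim : Tendsto (fun t => mehlerSemigroup T μ t f x) (𝓝[>] 0) (𝓝 (f x)))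
    {α : ℕ → ℝ} (hα : ∀ n, 0 < α n) (hαlim : Tendsto α atTop atTop) :
    Tendsto (fun n => ENNReal.ofReal (α n) * mehlerResolvent T μ (α n) f x) atTop (𝓝 (f x)) := by
  have h1 : ∀ n, ENNReal.ofReal (α n) * mehlerResolvent T μ (α n) f x =
      ∫⁻ s in Ioi (0 : ℝ), expWeight 1 s * mehlerSemigroup T μ (max (s / α n) 0) f x := by
    intro n
    have hF : Measurable fun s =>
        expWeight 1 s * mehlerSemigroup T μ (max (s / α n) 0) f x :=
      (measurable_expWeight 1).mul ((measurable_mehlerSemigroup_time hT hμ hf x).comp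
        (measurable_id.div_const _))
    rw [← setLIntegral_Ioi_comp_mul (hα n) hF, mehlerResolvent_eq_max]
    simp only [mul_div_cancel_left₀ _ (hα n).ne']
    congr 3 with t
    simp [expWeight]
  have h2 : f x = ∫⁻ s in Ioi (0 : ℝ), expWeight 1 s * f x := by
    rw [lintegral_mul_const _ (measurable_expWeight 1), lintegral_Ioi_expWeight one_pos]
    simp
  rw [h2]
  simp_rw [h1]
  refine tendsto_lintegral_of_dominated_convergence (fun s => expWeight 1 s * c) (fun n => ?_)
    (fun n => Eventually.of_forall fun s => ?_) ?_ ?_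
  · exact (measurable_expWeight 1).mul ((measurable_mehlerSemigroup_time hT hμ hf x).comp
      (measurable_id.div_const _))
  · exact mul_le_mul_right ((mehlerSemigroup_mono hfc _ _).trans_eq (mehlerSemigroup_const _ _ _)) _
  · rw [lintegral_mul_const _ (measurable_expWeight 1), lintegral_Ioi_expWeight one_pos]
    simpa using hc
  · filter_upwards [ae_restrict_mem measurableSet_Ioi] with s hs
    have hs : 0 < s := hs
    refine ENNReal.Tendsto.const_mul ?_ (Or.inr ENNReal.ofReal_ne_top)
    refine hlim.comp (tendsto_nhdsWithin_iff.2 ⟨?_, Eventually.of_forall fun n => ?_⟩)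
    · have h3 : Tendsto (fun n => max (s / α n) 0) atTop (𝓝 (max 0 0)) :=
        (tendsto_const_nhds.div_atTop hαlim).max tendsto_const_nhds
      simpa using h3
    · exact lt_max_of_lt_left (div_pos hs (hα n))

/-- A probability measure `ν` is determined by `ν U_1`: by the resolvent equation `ν U_1` determines
`ν U_α` for `α > 1`, and `α U_α f → f`. -/
theorem ext_of_resolvent [CompleteSpace H] {ν₁ ν₂ : Measure H} [IsProbabilityMeasure ν₁]
    [IsProbabilityMeasure ν₂]
    (h : ∀ f : H → ℝ≥0∞, Measurable f →
      ∫⁻ x, mehlerResolvent T μ 1 f x ∂ν₁ = ∫⁻ x, mehlerResolvent T μ 1 f x ∂ν₂) : ν₁ = ν₂ := by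
  have hstep : ∀ γ : ℝ, 0 < γ → ∀ f : H → ℝ≥0∞, Measurable f → (∀ z, f z ≤ 2) →
      ∫⁻ x, mehlerResolvent T μ (γ + 1) f x ∂ν₁ = ∫⁻ x, mehlerResolvent T μ (γ + 1) f x ∂ν₂ := by
    intro γ hγ f hf hf2
    have hm := measurable_mehlerResolvent hT hμ (γ + 1) hf
    have hm1 := measurable_mehlerResolvent hT hμ 1 hm
    have heq : ∀ ν : Measure H, ∫⁻ x, mehlerResolvent T μ (γ + 1) f x ∂ν + ENNReal.ofReal γ *
        ∫⁻ x, mehlerResolvent T μ 1 (mehlerResolvent T μ (γ + 1) f) x ∂ν =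
          ∫⁻ x, mehlerResolvent T μ 1 f x ∂ν := by
      intro ν
      rw [← lintegral_const_mul _ hm1, ← lintegral_add_left hm]
      refine lintegral_congr fun x => ?_
      rw [mehlerResolvent_comm hT hμ 1 (γ + 1) hf, resolvent_equation hT hμ 1 hγ hf]
    have h1 := heq ν₁
    rw [h f hf, ← heq ν₂, h _ hm] at h1
    refine (ENNReal.add_left_inj (ENNReal.mul_ne_top ENNReal.ofReal_ne_top ?_)).1 h1
    have hb : ∀ x, mehlerResolvent T μ 1 (mehlerResolvent T μ (γ + 1) f) x ≤
        (ENNReal.ofReal 1)⁻¹ * ((ENNReal.ofReal (γ + 1))⁻¹ * 2) :=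
      mehlerResolvent_le_of_le one_pos (mehlerResolvent_le_of_le (by linarith) hf2)
    refine ne_top_of_le_ne_top ?_ (lintegral_mono hb)
    rw [lintegral_const, measure_univ, mul_one]
    refine ENNReal.mul_ne_top (by simp) (ENNReal.mul_ne_top ?_ (by simp))
    exact ENNReal.inv_ne_top.2 (ENNReal.ofReal_pos.2 (by linarith)).ne'
  have hα : ∀ n : ℕ, (0 : ℝ) < ((n : ℝ) + 1) + 1 := fun n => by positivity
  have hαlim : Tendsto (fun n : ℕ => ((n : ℝ) + 1) + 1) atTop atTop :=
    (tendsto_natCast_atTop_atTop.atTop_add tendsto_const_nhds).atTop_add tendsto_const_nhds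
  have htrig : ∀ (ξ : H) (θ : ℝ), ∫⁻ x, trigE ξ θ x ∂ν₁ = ∫⁻ x, trigE ξ θ x ∂ν₂ := by
    intro ξ θ
    have hlim : ∀ ν : Measure H, [IsProbabilityMeasure ν] → Tendsto (fun n : ℕ =>
        ∫⁻ x, ENNReal.ofReal (((n : ℝ) + 1) + 1) *
          mehlerResolvent T μ (((n : ℝ) + 1) + 1) (trigE ξ θ) x ∂ν) atTop
        (𝓝 (∫⁻ x, trigE ξ θ x ∂ν)) := by
      intro ν _
      refine tendsto_lintegral_of_dominated_convergence (fun _ => 2) (fun n => ?_)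
        (fun n => Eventually.of_forall fun x => ?_) (by simp) (Eventually.of_forall fun x => ?_)
      · exact (measurable_mehlerResolvent hT hμ _ (measurable_trigE ξ θ)).const_mul _
      · refine (mul_le_mul_right
          (mehlerResolvent_le_of_le (hα n) (trigE_le_two ξ θ) x) _).trans_eq ?_
        rw [← mul_assoc, ENNReal.mul_inv_cancel (ENNReal.ofReal_pos.2 (hα n)).ne'
          ENNReal.ofReal_ne_top, one_mul]
      · refine tendsto_mul_mehlerResolvent hT hμ (measurable_trigE ξ θ) (c := 2) (by simp)
          (trigE_le_two ξ θ) ?_ hα hαlim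
        exact tendsto_mehlerSemigroup hT hμ x (BoundedContinuousFunction.mkOfBound
          ⟨fun z => (trig ξ θ z).toNNReal, continuous_real_toNNReal.comp (continuous_trig ξ θ)⟩ 2
          fun z w => by
            simp only [ContinuousMap.coe_mk, NNReal.dist_eq,
              Real.coe_toNNReal _ (trig_nonneg ξ θ _)]
            rw [abs_le]
            have h1 := trig_nonneg ξ θ z
            have h2 := trig_nonneg ξ θ w
            have h3 := trig_le_two ξ θ z
            have h4 := trig_le_two ξ θ w
            constructor <;> linarith)
    refine tendsto_nhds_unique (hlim ν₁) ((hlim ν₂).congr fun n => ?_)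
    rw [lintegral_const_mul _ (measurable_mehlerResolvent hT hμ _ (measurable_trigE ξ θ)),
      lintegral_const_mul _ (measurable_mehlerResolvent hT hμ _ (measurable_trigE ξ θ)),
      hstep _ (by positivity) _ (measurable_trigE ξ θ) (trigE_le_two ξ θ)]
  exact ext_of_trigE (TopologicalSpace.denseRange_denseSeq H) (fun n => htrig _ _)
    fun n => htrig _ _

theorem ext_of_resolvent_trigE [CompleteSpace H] {ν₁ ν₂ : Measure H} [IsProbabilityMeasure ν₁]
    [IsProbabilityMeasure ν₂] {d : ℕ → H} (hd : DenseRange d)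
    (h0 : ∀ n, ∫⁻ x, mehlerResolvent T μ 1 (trigE (d n) 0) x ∂ν₁ =
      ∫⁻ x, mehlerResolvent T μ 1 (trigE (d n) 0) x ∂ν₂)
    (h1 : ∀ n, ∫⁻ x, mehlerResolvent T μ 1 (trigE (d n) (Real.pi / 2)) x ∂ν₁ =
      ∫⁻ x, mehlerResolvent T μ 1 (trigE (d n) (Real.pi / 2)) x ∂ν₂) : ν₁ = ν₂ := by
  obtain ⟨m₁, hm₁⟩ := exists_measure_lintegral_resolvent hT hμ 1 ν₁
  obtain ⟨m₂, hm₂⟩ := exists_measure_lintegral_resolvent hT hμ 1 ν₂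
  have hprob : ∀ (ν m : Measure H), [IsProbabilityMeasure ν] → (∀ f : H → ℝ≥0∞, Measurable f →
      ∫⁻ z, f z ∂m = ∫⁻ x, mehlerResolvent T μ 1 f x ∂ν) → m univ = 1 := by
    intro ν m _ hm
    rw [← lintegral_one, hm (fun _ => 1) measurable_const]
    simp [mehlerResolvent_const one_pos]
  have : IsProbabilityMeasure m₁ := ⟨hprob ν₁ m₁ hm₁⟩
  have : IsProbabilityMeasure m₂ := ⟨hprob ν₂ m₂ hm₂⟩
  have hm : m₁ = m₂ := ext_of_trigE hd
    (fun n => by rw [hm₁ _ (measurable_trigE _ _), hm₂ _ (measurable_trigE _ _), h0])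
    fun n => by rw [hm₁ _ (measurable_trigE _ _), hm₂ _ (measurable_trigE _ _), h1]
  exact ext_of_resolvent hT hμ fun f hf => by rw [← hm₁ f hf, ← hm₂ f hf, hm]

/-- The potentials of trigonometric functions are continuous along weakly continuous maps from a
first countable space. -/
theorem continuous_mehlerResolvent_trigE [CompleteSpace H] {X : Type*} [TopologicalSpace X]
    [FirstCountableTopology X] {ι : X → H} (hι : ∀ η : H, Continuous fun x => inner ℝ (ι x) η)
    {α : ℝ} (hα : 0 < α) (ξ : H) (θ : ℝ) :
    Continuous fun x => mehlerResolvent T μ α (trigE ξ θ) (ι x) := by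
  rw [continuous_iff_continuousAt]
  intro x
  simp only [ContinuousAt, mehlerResolvent_eq_max]
  refine tendsto_lintegral_filter_of_dominated_convergence (fun t => expWeight α t * 2)
    (Eventually.of_forall fun w => ?_)
    (Eventually.of_forall fun w => Eventually.of_forall fun t => ?_)
    ?_ (Eventually.of_forall fun t => ?_)
  · exact (measurable_expWeight α).mul
      (measurable_mehlerSemigroup_time hT hμ (measurable_trigE ξ θ) _)
  · exact mul_le_mul_right ((mehlerSemigroup_mono (trigE_le_two ξ θ) _ _).trans_eq
      (mehlerSemigroup_const _ _ _)) _
  · rw [lintegral_mul_const _ (measurable_expWeight α), lintegral_Ioi_expWeight hα]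
    exact ENNReal.mul_ne_top (ENNReal.inv_ne_top.2 (ENNReal.ofReal_pos.2 hα).ne') (by simp)
  · refine ENNReal.Tendsto.const_mul ?_ (Or.inr ENNReal.ofReal_ne_top)
    set S := T (max t 0)
    refine tendsto_lintegral_filter_of_dominated_convergence (fun _ => 2)
      (Eventually.of_forall fun w => (measurable_trigE ξ θ).comp (by fun_prop))
      (Eventually.of_forall fun w => Eventually.of_forall fun y => trigE_le_two ξ θ _)
      (by simp) (Eventually.of_forall fun y => ?_)
    have hc : Continuous fun w => trigE ξ θ (S (ι w) + y) := by
      have h1 := hι (ContinuousLinearMap.adjoint S ξ)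
      simp only [ContinuousLinearMap.adjoint_inner_right] at h1
      unfold trigE trig
      simp only [inner_add_left]
      exact ENNReal.continuous_ofReal.comp (by fun_prop)
    exact hc.tendsto x

end Separation

/-! ### Weak compactness of balls -/

section WeakTopology

variable {H : Type*} [NormedAddCommGroup H] [InnerProductSpace ℝ H]

theorem continuous_inner_weakTopology (η : H) :
    @Continuous H ℝ (weakTopology H) _ fun x => inner ℝ x η := by
  have h0 : @Continuous H (WeakSpace ℝ H) (weakTopology H) _ (toWeakSpace ℝ H) :=
    continuous_induced_dom
  have h1 := @Continuous.comp H (WeakSpace ℝ H) ℝ (weakTopology H) _ _ _ _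
    (WeakBilin.eval_continuous (topDualPairing ℝ H).flip (innerSL ℝ η)) h0
  convert h1 using 2 with x
  rw [real_inner_comm]
  rfl

theorem t2Space_weakTopology : @T2Space H (weakTopology H) := by
  refine @T2Space.of_injective_continuous H (H → ℝ) (weakTopology H) _ _
    (fun x η => inner ℝ x η) (fun x y hxy => ext_inner_right ℝ fun η => congrFun hxy η) ?_
  exact (@continuous_pi_iff H H (fun _ => ℝ) (weakTopology H) _ _).2 continuous_inner_weakTopology

/-- Closed balls are weakly compact, by the Banach-Alaoglu theorem and the Riesz representation. -/
theorem isCompact_closedBall_weakTopology [CompleteSpace H] (r : ℝ) :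
    @IsCompact H (weakTopology H) (Metric.closedBall 0 r) := by
  have h1 := WeakDual.isCompact_closedBall (𝕜 := ℝ) (E := H) 0 r
  set Φ : WeakDual ℝ H → H := fun f =>
    (InnerProductSpace.toDual ℝ H).symm (WeakDual.toStrongDual f) with hΦ
  have hcont : @Continuous (WeakDual ℝ H) H _ (weakTopology H) Φ := by
    refine continuous_induced_rng.2 (WeakBilin.continuous_of_continuous_eval _ fun y => ?_)
    have h2 : Continuous fun f : WeakDual ℝ H => f ((InnerProductSpace.toDual ℝ H).symm y) :=
      WeakDual.eval_continuous _
    refine h2.congr fun f => ?_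
    show f _ = y (Φ f)
    rw [← InnerProductSpace.toDual_symm_apply (𝕜 := ℝ) (y := y), real_inner_comm]
    exact (InnerProductSpace.toDual_symm_apply (𝕜 := ℝ) (y := WeakDual.toStrongDual f)).symm
  have h2 := @IsCompact.image _ _ _ (weakTopology H) _ _ h1 hcont
  convert h2 using 1
  ext x
  constructor
  · intro hx
    refine ⟨WeakDual.toStrongDual.symm (InnerProductSpace.toDual ℝ H x), ?_, ?_⟩
    · simpa using hx
    · simp [hΦ]
  · rintro ⟨f, hf, rfl⟩
    simpa [hΦ] using hf

/-- A compact topology finer than a Hausdorff topology is equal to it. -/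
theorem eq_of_le_of_compactSpace_of_t2Space {Y : Type*} {t₁ t₂ : TopologicalSpace Y}
    (h₁ : @CompactSpace Y t₁) (h₂ : @T2Space Y t₂) (h : t₁ ≤ t₂) : t₁ = t₂ := by
  refine le_antisymm h fun s hs => (@isClosed_compl_iff Y t₂ s).1 ?_
  have hc : @IsCompact Y t₁ sᶜ :=
    @IsClosed.isCompact Y t₁ _ h₁ ((@isClosed_compl_iff Y t₁ s).2 hs)
  have hi := @IsCompact.image Y Y t₁ t₂ _ id hc (continuous_id_iff_le.2 h)
  rw [image_id] at hi
  exact @IsCompact.isClosed Y t₂ h₂ _ hi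

/-- A Hausdorff topology that is coarser on a compact set than another Hausdorff topology agrees
with it there. -/
theorem induced_eq_and_isClosed_of_isCompact {X : Type*} {σ τ : TopologicalSpace X} {K : Set X}
    (hK : @IsCompact X σ K) (hσ : @T2Space X σ) (hτ : @T2Space X τ)
    (hle : TopologicalSpace.induced ((↑) : K → X) σ ≤ TopologicalSpace.induced ((↑) : K → X) τ) :
    TopologicalSpace.induced ((↑) : K → X) σ = TopologicalSpace.induced ((↑) : K → X) τ ∧
      IsClosed[σ] K ∧ IsClosed[τ] K := by
  have hcs : @CompactSpace K (TopologicalSpace.induced ((↑) : K → X) σ) :=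
    (@isCompact_iff_compactSpace X σ K).1 hK
  have ht2 : @T2Space K (TopologicalSpace.induced ((↑) : K → X) τ) :=
    @instT2SpaceSubtype X τ (· ∈ K) hτ
  have heq := eq_of_le_of_compactSpace_of_t2Space hcs ht2 hle
  refine ⟨heq, @IsCompact.isClosed X σ hσ K hK, ?_⟩
  rw [heq] at hcs
  exact @IsCompact.isClosed X τ hτ K ((@isCompact_iff_compactSpace X τ K).2 hcs)

end WeakTopology

/-! ### The topology generated by trigonometric potentials -/

section UTopology

variable {H : Type*} [NormedAddCommGroup H] [InnerProductSpace ℝ H]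

theorem toENNReal_neg_trig (ξ : H) (θ : ℝ) (x : H) :
    (-((trig ξ θ x : ℝ) : EReal)).toENNReal = 0 := by
  refine EReal.toENNReal_of_nonpos ?_
  rw [EReal.neg_le, neg_zero]
  exact_mod_cast trig_nonneg ξ θ x

theorem abs_trig (ξ : H) (θ : ℝ) (x : H) : ((trig ξ θ x : ℝ) : EReal).abs = trigE ξ θ x := by
  rw [EReal.abs_def, abs_of_nonneg (trig_nonneg ξ θ x), trigE]

variable {T : ℝ → H →L[ℝ] H} [MeasurableSpace H] {μ : ℝ → ProbabilityMeasure H}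

theorem mehlerResolvent_zero (α : ℝ) (x : H) : mehlerResolvent T μ α (fun _ => 0) x = 0 := by
  simp [mehlerResolvent, mehlerSemigroup]

theorem potential_trig (α : ℝ) (ξ : H) (θ : ℝ) (x : H) :
    potential (mehlerResolvent T μ) α (fun y => ((trig ξ θ y : ℝ) : EReal)) x =
      ((mehlerResolvent T μ α (trigE ξ θ) x : ℝ≥0∞) : EReal) := by
  simp only [potential, toENNReal_neg_trig, mehlerResolvent_zero, EReal.real_coe_toENNReal,
    EReal.coe_ennreal_zero, sub_zero]
  rfl

theorem mehlerResolvent_one_trigE_le (ξ : H) (θ : ℝ) (x : H) :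
    mehlerResolvent T μ 1 (trigE ξ θ) x ≤ 2 := by
  simpa using mehlerResolvent_le_of_le (T := T) (μ := μ) one_pos (trigE_le_two ξ θ) x

theorem lintegral_mehlerResolvent_trigE_lt_top (ξ : H) (θ : ℝ) (ν : Measure H)
    [IsProbabilityMeasure ν] : ∫⁻ x, mehlerResolvent T μ 1 (trigE ξ θ) x ∂ν < ∞ := by
  refine (lintegral_mono (mehlerResolvent_one_trigE_le ξ θ)).trans_lt ?_
  simp

/-- The topology generated by the potentials `U_1 (1 + cos⟨·, d_n⟩)` and `U_1 (1 + sin⟨·, d_n⟩)`,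
which are placed at the even and the odd indices. -/
@[reducible] noncomputable def trigTopology (T : ℝ → H →L[ℝ] H)
    (μ : ℝ → ProbabilityMeasure H) (d : ℕ → H) :
    TopologicalSpace H :=
  ⨅ k : ℕ, TopologicalSpace.induced (potential (mehlerResolvent T μ) 1 fun y =>
    ((trig (d (k / 2)) ((k % 2 : ℕ) * (Real.pi / 2)) y : ℝ) : EReal)) inferInstance

variable [BorelSpace H] [SecondCountableTopology H] [CompleteSpace H]
  (hT : IsC0Semigroup T) (hμ : IsMehlerFamily T μ)
include hT hμ

theorem ext_of_trig_potentials {d : ℕ → H} (hd : DenseRange d) {ν₁ ν₂ : Measure H}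
    [IsProbabilityMeasure ν₁] [IsProbabilityMeasure ν₂]
    (h : ∀ k : ℕ, ∫⁻ x, mehlerResolvent T μ 1
        (trigE (d (k / 2)) ((k % 2 : ℕ) * (Real.pi / 2))) x ∂ν₁ =
      ∫⁻ x, mehlerResolvent T μ 1 (trigE (d (k / 2)) ((k % 2 : ℕ) * (Real.pi / 2))) x ∂ν₂) :
    ν₁ = ν₂ := by
  refine ext_of_resolvent_trigE hT hμ hd (fun n => ?_) fun n => ?_
  · simpa using h (2 * n)
  · have h1 : (2 * n + 1) / 2 = n := by omega
    have h2 : (2 * n + 1) % 2 = 1 := by omega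
    simpa [h1, h2] using h (2 * n + 1)

theorem isUTopology_trigTopology {d : ℕ → H} (hd : DenseRange d) :
    IsUTopology (mehlerResolvent T μ) (trigTopology T μ d) := by
  refine ⟨fun _ => 1, fun k y => ((trig (d (k / 2)) ((k % 2 : ℕ) * (Real.pi / 2)) y : ℝ) : EReal),
    0, fun _ => 2, ⟨le_rfl, one_pos, fun _ => le_rfl⟩, fun k =>
      (continuous_trig _ _).measurable.coe_real_ereal, isExcessive_const le_rfl 2, fun x => ?_,
    fun k x => ?_, fun k x => Or.inr ?_, rfl, fun ν₁ ν₂ _ _ h => ?_⟩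
  · simpa using mehlerResolvent_zero (T := T) (μ := μ) 1 x
  · rw [abs_trig]
    exact trigE_le_two _ _ _
  · simp only [toENNReal_neg_trig, mehlerResolvent_zero, ENNReal.zero_lt_top]
  · refine ProbabilityMeasure.toMeasure_injective (ext_of_trig_potentials hT hμ hd fun k => ?_)
    have h1 := h k
    simp only [potential_trig, EReal.toReal_coe_ennreal] at h1
    have h2 : ∀ ν : Measure H, ∫ x, (mehlerResolvent T μ 1 (trigE (d (k / 2))
        ((k % 2 : ℕ) * (Real.pi / 2))) x).toReal ∂ν = (∫⁻ x, mehlerResolvent T μ 1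
          (trigE (d (k / 2)) ((k % 2 : ℕ) * (Real.pi / 2))) x ∂ν).toReal := fun ν =>
      integral_toReal (measurable_mehlerResolvent hT hμ 1 (measurable_trigE _ _)).aemeasurable
        (Eventually.of_forall fun x =>
          (mehlerResolvent_one_trigE_le _ _ x).trans_lt ENNReal.ofNat_lt_top)
    rw [h2, h2] at h1
    exact (ENNReal.toReal_eq_toReal_iff' (lintegral_mehlerResolvent_trigE_lt_top _ _ _).ne
      (lintegral_mehlerResolvent_trigE_lt_top _ _ _).ne).1 h1

/-- The generating potentials separate points because they separate Dirac measures. -/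
theorem t2Space_trigTopology {d : ℕ → H} (hd : DenseRange d) :
    @T2Space H (trigTopology T μ d) := by
  refine @T2Space.of_injective_continuous H (ℕ → EReal) (trigTopology T μ d) _ _
    (fun x k => potential (mehlerResolvent T μ) 1 (fun y =>
      ((trig (d (k / 2)) ((k % 2 : ℕ) * (Real.pi / 2)) y : ℝ) : EReal)) x) ?_ ?_
  · intro x y hxy
    have h1 : Measure.dirac x = Measure.dirac y := by
      refine ext_of_trig_potentials hT hμ hd fun k => ?_
      have h2 := congrFun hxy k
      simp only [potential_trig, EReal.coe_ennreal_eq_coe_ennreal_iff] at h2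
      rw [lintegral_dirac' _ (measurable_mehlerResolvent hT hμ 1 (measurable_trigE _ _)),
        lintegral_dirac' _ (measurable_mehlerResolvent hT hμ 1 (measurable_trigE _ _)), h2]
    exact (dirac_eq_dirac_iff).1 h1
  · refine (@continuous_pi_iff H ℕ (fun _ => EReal) (trigTopology T μ d) _ _).2 fun k => ?_
    exact continuous_iff_le_induced.2 (iInf_le _ k)

/-- On a weakly compact set, which is metrizable in the weak topology, the generating potentials are
weakly continuous. -/
theorem induced_weakTopology_le_trigTopology {d : ℕ → H} (hd : DenseRange d) {K : Set H}
    (hK : @IsCompact H (weakTopology H) K) :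
    TopologicalSpace.induced ((↑) : K → H) (weakTopology H) ≤
      TopologicalSpace.induced ((↑) : K → H) (trigTopology T μ d) := by
  rw [trigTopology, induced_iInf]
  refine le_iInf fun k => le_of_le_of_eq ?_ induced_compose.symm
  let t : TopologicalSpace K := TopologicalSpace.induced ((↑) : K → H) (weakTopology H)
  have hcs : CompactSpace K := (@isCompact_iff_compactSpace H (weakTopology H) K).1 hK
  have hinner : ∀ η : H, Continuous fun x : K => inner ℝ (x : H) η := fun η =>
    @Continuous.comp K H ℝ t (weakTopology H) _ _ _ (continuous_inner_weakTopology η)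
      continuous_induced_dom
  have hmet : TopologicalSpace.MetrizableSpace K :=
    Metric.PiNatEmbed.TopologicalSpace.MetrizableSpace.of_countable_separating
      (fun n (x : K) => inner ℝ (x : H) (d n)) (fun n => hinner (d n)) fun x y hxy => by
        by_contra! hall
        refine hxy (Subtype.ext (ext_inner_right ℝ fun η => ?_))
        exact congrFun (hd.equalizer (by fun_prop) (by fun_prop) (funext hall)) η
  have h1 := continuous_mehlerResolvent_trigE hT hμ hinner one_pos (d (k / 2))
    ((k % 2 : ℕ) * (Real.pi / 2))
  exact continuous_iff_le_induced.1 ((continuous_coe_ennreal_ereal.comp h1).congr fun x =>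
    (potential_trig 1 _ _ _).symm)

end UTopology

end MehlerWeak

theorem proposition4p4 {H : Type*} [NormedAddCommGroup H] [InnerProductSpace ℝ H]
    [CompleteSpace H] [TopologicalSpace.SeparableSpace H] [MeasurableSpace H] [BorelSpace H]
    (T : ℝ → H →L[ℝ] H) (hT : MehlerWeak.IsC0Semigroup T)
    (μ : ℝ → ProbabilityMeasure H) (hμ : MehlerWeak.IsMehlerFamily T μ)
    (hA : MehlerWeak.GeneratorBounded T ∨ MehlerWeak.ConditionHAmu T μ) :
    MehlerWeak.IsQuasiUTopology (MehlerWeak.mehlerResolvent T μ) (MehlerWeak.weakTopology H)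
      (fun n : ℕ => Metric.closedBall (0 : H) ((n : ℝ) + 1)) := by
  have : SecondCountableTopology H := UniformSpace.secondCountable_of_separable H
  have hd := TopologicalSpace.denseRange_denseSeq H
  refine ⟨hA.elim (MehlerWeak.isNest_of_bounded hT hμ) (MehlerWeak.isNest_of_conditionHAmu hT hμ),
    _, MehlerWeak.isUTopology_trigTopology hT hμ hd, fun n => ?_⟩
  have hK := MehlerWeak.isCompact_closedBall_weakTopology (H := H) ((n : ℝ) + 1)
  exact MehlerWeak.induced_eq_and_isClosed_of_isCompact hK MehlerWeak.t2Space_weakTopology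
    (MehlerWeak.t2Space_trigTopology hT hμ hd)
    (MehlerWeak.induced_weakTopology_le_trigTopology hT hμ hd hK)
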